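/- Let $\Theta \subseteq \mathbb{R}^d$ be open and let $(p_\theta)_{\theta \in \Theta}$ be probability densities with respect to a measure $\mu$. The family is differentiable in quadratic mean (DQM) at $\theta$ with score $\dot\ell_\theta : \mathcal X \to \mathbb{R}^d$ if $$\int \Bigl( \sqrt{p_{\theta+h}} - \sqrt{p_\theta} - \tfrac12 h^T \dot\ell_\theta \sqrt{p_\theta} \Bigr)^2 d\mu = o(\|h\|^2) \quad (h \to 0),$$ and it is doubly differentiable in quadratic mean (DDQM) at $\theta$, with scores $\dot\ell_{\theta'}$, if for all sequences $h, \tilde h \to 0$ $$\int \Bigl( \sqrt{p_{\theta+h}} - \sqrt{p_{\theta+\tilde h}} - \tfrac12 (h-\tilde h)^T \dot\ell_{\theta+\tilde h} \sqrt{p_{\theta+\tilde h}} \Bigr)^2 d\mu = o(\|h-\tilde h\|^2).$$ Write $I(\theta) = \int \dot\ell_\theta \dot\ell_\theta^T p_\theta \, d\mu$ for the Fisher information of one observation. **Theorem.** Let $\theta \in \Theta$. Suppose that the family is DQM with score $\dot\ell_{\theta'}$ at every $\theta'$ in some neighbourhood of $\theta$, and that, with these scores, it is DDQM at $\theta$.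 Let $h_n, \tilde h_n \to 0$ be sequences with $\theta + h_n, \theta + \tilde h_n \in \Theta$ and $\sqrt n\,(h_n - \tilde h_n) \to k$. For each $n$ let $X_1, \dots, X_n$ be independent with common density $p_{\theta + \tilde h_n}$, and put $\ell(\theta') = \sum_{i=1}^n \log p_{\theta'}(X_i)$ and $\dot\ell(\theta') = \sum_{i=1}^n \dot\ell_{\theta'}(X_i)$. Then, under the law of this sample, with probability tending to $1$ all the $p_{\theta+h_n}(X_i)$ and $p_{\theta+\tilde h_n}(X_i)$ are positive (so that $\ell(\theta+h_n)$ and $\ell(\theta+\tilde h_n)$ are finite), and $$\ell(\theta + h_n) - \ell(\theta + \tilde h_n) = \frac{1}{\sqrt n}\, k^T \dot\ell(\theta + \tilde h_n) - \frac12 k^T I(\theta) k + o_p(1),$$ $$\ell(\theta + h_n) - \ell(\theta + \tilde h_n) \longrightarrow^d N\Bigl(-\tfrac12 k^T I(\theta) k,\; k^T I(\theta) k\Bigr),$$ where $N(0,0)$ is the point mass at $0$, and where the value given to $\log 0$ is immaterial. -/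

import Mathlib

open MeasureTheory ProbabilityTheory Filter Asymptotics
open scoped Topology Matrix

noncomputable section

namespace LocalAsymptotics

variable {𝒳 : Type*} [MeasurableSpace 𝒳] {d : ℕ}

/-- `p θ`, for `θ ∈ Θ`, is a probability density with respect to `μ`. -/
structure IsDensityFamily (μ : Measure 𝒳) (Θ : Set (EuclideanSpace ℝ (Fin d)))
    (p : EuclideanSpace ℝ (Fin d) → 𝒳 → ℝ) : Prop where
  measurable : ∀ θ ∈ Θ, Measurable (p θ)
  nonneg : ∀ θ ∈ Θ, ∀ x, 0 ≤ p θ x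
  lintegral_eq_one : ∀ θ ∈ Θ, ∫⁻ x, ENNReal.ofReal (p θ x) ∂μ = 1

/-- The distribution `P_θ` with density `p θ` with respect to `μ`. -/
def law (μ : Measure 𝒳) (p : EuclideanSpace ℝ (Fin d) → 𝒳 → ℝ)
    (θ : EuclideanSpace ℝ (Fin d)) : Measure 𝒳 :=
  μ.withDensity fun x => ENNReal.ofReal (p θ x)

/-- The remainder `√p_{θ₁} - √p_{θ₀} - ½ (θ₁ - θ₀)ᵀ s √p_{θ₀}` of the first order expansion of
the root density around `θ₀`, where `s` is a candidate for the score at `θ₀`. -/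
def rootRemainder (p : EuclideanSpace ℝ (Fin d) → 𝒳 → ℝ) (s : 𝒳 → EuclideanSpace ℝ (Fin d))
    (θ₀ θ₁ : EuclideanSpace ℝ (Fin d)) (x : 𝒳) : ℝ :=
  √(p θ₁ x) - √(p θ₀ x) - (1 / 2) * inner ℝ (θ₁ - θ₀) (s x) * √(p θ₀ x)

/-- The family `p` is differentiable in quadratic mean at `θ`, with score `s`:
`∫ (√p_{θ+h} - √p_θ - ½ hᵀ s √p_θ)² dμ = o(‖h‖²)` as `h → 0`.
(The integrability clause says that the integral is finite for small `h`.) -/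
def HasDQMScore (μ : Measure 𝒳) (p : EuclideanSpace ℝ (Fin d) → 𝒳 → ℝ)
    (s : 𝒳 → EuclideanSpace ℝ (Fin d)) (θ : EuclideanSpace ℝ (Fin d)) : Prop :=
  (∀ᶠ h in 𝓝 (0 : EuclideanSpace ℝ (Fin d)),
      Integrable (fun x => rootRemainder p s θ (θ + h) x ^ 2) μ) ∧
    (fun h : EuclideanSpace ℝ (Fin d) => ∫ x, rootRemainder p s θ (θ + h) x ^ 2 ∂μ)
      =o[𝓝 0] fun h => ‖h‖ ^ 2

/-- The family `p` with score function `score` is doubly differentiable in quadratic mean at `θ`: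
for all sequences `h, h' → 0`,
`∫ (√p_{θ+h} - √p_{θ+h'} - ½ (h-h')ᵀ score(θ+h') √p_{θ+h'})² dμ = o(‖h-h'‖²)`.
(The integrability clause says that the integral is eventually finite.) -/
def IsDDQM (μ : Measure 𝒳) (p : EuclideanSpace ℝ (Fin d) → 𝒳 → ℝ)
    (score : EuclideanSpace ℝ (Fin d) → 𝒳 → EuclideanSpace ℝ (Fin d))
    (θ : EuclideanSpace ℝ (Fin d)) : Prop :=
  ∀ h h' : ℕ → EuclideanSpace ℝ (Fin d), Tendsto h atTop (𝓝 0) → Tendsto h' atTop (𝓝 0) →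
    (∀ᶠ n in atTop,
      Integrable (fun x => rootRemainder p (score (θ + h' n)) (θ + h' n) (θ + h n) x ^ 2) μ) ∧
    (fun n => ∫ x, rootRemainder p (score (θ + h' n)) (θ + h' n) (θ + h n) x ^ 2 ∂μ)
      =o[atTop] fun n => ‖h n - h' n‖ ^ 2

/-- The Fisher information matrix of one observation, `I(θ) = E_θ[score(θ) score(θ)ᵀ]`. -/
def fisherInfo (μ : Measure 𝒳) (p : EuclideanSpace ℝ (Fin d) → 𝒳 → ℝ)
    (score : EuclideanSpace ℝ (Fin d) → 𝒳 → EuclideanSpace ℝ (Fin d))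
    (θ : EuclideanSpace ℝ (Fin d)) : Matrix (Fin d) (Fin d) ℝ :=
  Matrix.of fun i j => ∫ x, score θ x i * score θ x j ∂(law μ p θ)

/-- The quadratic form `kᵀ A k`. -/
def quadForm (A : Matrix (Fin d) (Fin d) ℝ) (k : EuclideanSpace ℝ (Fin d)) : ℝ :=
  k.ofLp ⬝ᵥ (A *ᵥ k.ofLp)

/-- The log-likelihood `ℓ(θ) = ∑ᵢ log p_θ(xᵢ)` of a sample `x₁, …, xₙ`
(a genuine value only when all the `p_θ(xᵢ)` are positive). -/
def logLik (p : EuclideanSpace ℝ (Fin d) → 𝒳 → ℝ) {n : ℕ} (x : Fin n → 𝒳)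
    (θ : EuclideanSpace ℝ (Fin d)) : ℝ :=
  ∑ i, Real.log (p θ (x i))

/-- The score of a sample `x₁, …, xₙ`: the sum of the scores of the observations. -/
def sampleScore (score : EuclideanSpace ℝ (Fin d) → 𝒳 → EuclideanSpace ℝ (Fin d)) {n : ℕ}
    (x : Fin n → 𝒳) (θ : EuclideanSpace ℝ (Fin d)) : EuclideanSpace ℝ (Fin d) :=
  ∑ i, score θ (x i)

/-- `R n = o_p(1)`, where `R n` is defined on the probability space `(Ω n, P n)`. -/
def IsLittleOInProb {Ω : ℕ → Type*} [∀ n, MeasurableSpace (Ω n)] (P : ∀ n, Measure (Ω n))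
    (R : ∀ n, Ω n → ℝ) : Prop :=
  ∀ ε : ℝ, 0 < ε → Tendsto (fun n => P n {ω | ε ≤ |R n ω|}) atTop (𝓝 0)

end LocalAsymptotics

end

/-
In `L²(μ)` the root density `θ ↦ √p_θ` takes values in the unit sphere. Differentiability in
quadratic mean is its Fréchet differentiability, with derivative `k ↦ ½ kᵀ score_θ √p_θ`, and double
differentiability makes the derivatives at points `b n → θ` converge pointwise to the one at `θ`.
Hence `√n (√p_{a n} - √p_{b n}) → D = ½ kᵀ score_θ √p_θ` when `a n → θ` and `√n (a n - b n) → k`,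
and `4 ‖D‖² = kᵀ I(θ) k`.

The log-likelihood ratio is `∑ᵢ 2 log (1 + Wᵢ / 2)` with `W = 2 (√(p_{a n} / p_{b n}) - 1)`. By the
above, `W` is a Lindeberg array close in mean square to `V = kᵀ score_{b n} / √n`, so that all
`|Wᵢ|` are small with high probability and `∑ᵢ (2 log (1 + Wᵢ / 2) - Vᵢ)`, after truncation, has
vanishing variance. It therefore converges in probability to the limit of its mean. Here the scores
are centred, `W` has mean `-‖√p_{a n} - √p_{b n}‖²` because root densities are unit vectors, and the
quadratic term of the logarithm has mean `-¼ E W²`; each of the last two contributes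
`-¼ kᵀ I(θ) k`. Asymptotic normality is a Lindeberg central limit theorem for the truncated
logarithms, which are only approximately centred.
-/

namespace LocalAsymptotics

section Differentiability

variable {E F : Type*} [NormedAddCommGroup E] [NormedSpace ℝ E] [NormedAddCommGroup F]
  [NormedSpace ℝ F] {Ψ : E → F} {L : E →L[ℝ] F} {θ : E} {a b : ℕ → E} {D : ℕ → E →L[ℝ] F}

/- Increments of length comparable to `‖b n - θ‖` are seen by both `L` and `D n`, so the two
linear maps must agree on them up to a relative error tending to `0`. -/
lemma tendsto_apply_of_hasFDerivAt (hΨ : HasFDerivAt Ψ L θ) (hb : Tendsto b atTop (𝓝 θ))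
    (hD : ∀ a : ℕ → E, Tendsto a atTop (𝓝 θ) →
      (fun n => Ψ (a n) - Ψ (b n) - D n (a n - b n)) =o[atTop] fun n => a n - b n)
    {k : ℕ → E} {k₀ : E} (hk : Tendsto k atTop (𝓝 k₀)) :
    Tendsto (fun n => D n (k n)) atTop (𝓝 (L k₀)) := by
  let t : ℕ → ℝ := fun n => ‖b n - θ‖ + 1 / ((n : ℝ) + 1)
  have ht_pos (n : ℕ) : 0 < t n := by positivity
  have ht : Tendsto t atTop (𝓝 0) := by
    simpa [t] using (tendsto_iff_norm_sub_tendsto_zero.1 hb).add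
      (tendsto_one_div_add_atTop_nhds_zero_nat (𝕜 := ℝ))
  let a : ℕ → E := fun n => b n + t n • k n
  have ha : Tendsto a atTop (𝓝 θ) := by simpa [a] using hb.add (ht.smul hk)
  have hab : (fun n => a n - b n) =O[atTop] t := by
    simpa [a] using (isBigO_refl t atTop).smul (hk.isBigO_one ℝ)
  have hbθ : (fun n => b n - θ) =O[atTop] t :=
    .of_bound' (.of_forall fun n => by
      rw [Real.norm_of_nonneg (ht_pos n).le]
      exact le_add_of_nonneg_right (by positivity))
  have haθ : (fun n => a n - θ) =O[atTop] t := by simpa using hab.add hbθ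
  have hdiff : (fun n => t n • (D n (k n) - L (k n))) =o[atTop] t := by
    refine ((((hΨ.isLittleO.comp_tendsto ha).trans_isBigO haθ).sub
      ((hΨ.isLittleO.comp_tendsto hb).trans_isBigO hbθ)).sub
      ((hD a ha).trans_isBigO hab)).congr_left fun n => ?_
    simp only [Function.comp_apply, a, map_sub, map_add, map_smul, add_sub_cancel_left]
    module
  have hsub : Tendsto (fun n => D n (k n) - L (k n)) atTop (𝓝 0) :=
    hdiff.tendsto_inv_smul_nhds_zero.congr fun n => inv_smul_smul₀ (ht_pos n).ne' _
  simpa using hsub.add ((L.continuous.tendsto k₀).comp hk)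

lemma tendsto_smul_sub_of_hasFDerivAt (hΨ : HasFDerivAt Ψ L θ) (ha : Tendsto a atTop (𝓝 θ))
    (hb : Tendsto b atTop (𝓝 θ))
    (hD : ∀ a : ℕ → E, Tendsto a atTop (𝓝 θ) →
      (fun n => Ψ (a n) - Ψ (b n) - D n (a n - b n)) =o[atTop] fun n => a n - b n)
    {c : ℕ → ℝ} {k : E} (hk : Tendsto (fun n => c n • (a n - b n)) atTop (𝓝 k)) :
    Tendsto (fun n => c n • (Ψ (a n) - Ψ (b n))) atTop (𝓝 (L k)) := by
  have hrem : Tendsto (fun n => c n • (Ψ (a n) - Ψ (b n) - D n (a n - b n))) atTop (𝓝 0) :=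
    ((isLittleO_one_iff ℝ).1 <|
      ((isBigO_refl c atTop).smul_isLittleO (hD a ha)).trans_isBigO (hk.isBigO_one ℝ))
  simpa [smul_sub] using hrem.add (tendsto_apply_of_hasFDerivAt hΨ hb hD hk)

end Differentiability

section SquareIntegrable

lemma isLittleO_of_norm_sq {ι E F : Type*} [SeminormedAddCommGroup E] [SeminormedAddCommGroup F]
    {l : Filter ι} {u : ι → E} {v : ι → F}
    (h : (fun i => ‖u i‖ ^ 2) =o[l] fun i => ‖v i‖ ^ 2) : u =o[l] v :=
  (h.of_pow (f := fun i => ‖u i‖) (g := fun i => ‖v i‖) two_ne_zero).of_norm_norm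

variable {α : Type*} [MeasurableSpace α] {μ : Measure α} {u v : α → ℝ}

/-- The class of `u` in `L²(μ)`; by convention it is `0` when `u` is not square integrable. -/
noncomputable def toL2 (μ : Measure α) (u : α → ℝ) : Lp ℝ 2 μ :=
  open Classical in if hu : MemLp u 2 μ then hu.toLp u else 0

lemma toL2_eq_toLp (hu : MemLp u 2 μ) : toL2 μ u = hu.toLp u := dif_pos hu

lemma inner_toL2 (hu : MemLp u 2 μ) (hv : MemLp v 2 μ) :
    inner ℝ (toL2 μ u) (toL2 μ v) = ∫ x, u x * v x ∂μ := by
  rw [toL2_eq_toLp hu, toL2_eq_toLp hv, L2.inner_def]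
  refine integral_congr_ae ?_
  filter_upwards [hu.coeFn_toLp, hv.coeFn_toLp] with x hux hvx
  simp [hux, hvx, mul_comm]

lemma norm_toL2_sq (hu : MemLp u 2 μ) : ‖toL2 μ u‖ ^ 2 = ∫ x, u x ^ 2 ∂μ := by
  rw [← real_inner_self_eq_norm_sq, inner_toL2 hu hu]
  simp only [pow_two]

lemma toL2_add (hu : MemLp u 2 μ) (hv : MemLp v 2 μ) :
    toL2 μ (fun x => u x + v x) = toL2 μ u + toL2 μ v := by
  rw [toL2_eq_toLp hu, toL2_eq_toLp hv, ← MemLp.toLp_add]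
  exact toL2_eq_toLp (hu.add hv)

lemma toL2_sub (hu : MemLp u 2 μ) (hv : MemLp v 2 μ) :
    toL2 μ (fun x => u x - v x) = toL2 μ u - toL2 μ v := by
  rw [toL2_eq_toLp hu, toL2_eq_toLp hv, ← MemLp.toLp_sub]
  exact toL2_eq_toLp (hu.sub hv)

lemma toL2_const_mul (c : ℝ) (hu : MemLp u 2 μ) :
    toL2 μ (fun x => c * u x) = c • toL2 μ u := by
  rw [toL2_eq_toLp hu, ← MemLp.toLp_const_smul]
  exact toL2_eq_toLp (hu.const_mul c)

lemma norm_toL2_sub_sq (hu : MemLp u 2 μ) (hv : MemLp v 2 μ) :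
    ‖toL2 μ u - toL2 μ v‖ ^ 2 = ∫ x, (u x - v x) ^ 2 ∂μ := by
  rw [← toL2_sub hu hv]
  exact norm_toL2_sq (hu.sub hv)

end SquareIntegrable

section Densities

variable {𝒳 : Type*} [MeasurableSpace 𝒳] {μ : Measure 𝒳} {f g : 𝒳 → ℝ}

/-- `f` is a probability density with respect to `μ`. -/
structure IsDensity (μ : Measure 𝒳) (f : 𝒳 → ℝ) : Prop where
  measurable : Measurable f
  nonneg : ∀ x, 0 ≤ f x
  lintegral_eq_one : ∫⁻ x, ENNReal.ofReal (f x) ∂μ = 1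

/-- The distribution with density `f` with respect to `μ`, so that `law μ p θ` is by definition
`densityLaw μ (p θ)`. -/
noncomputable def densityLaw (μ : Measure 𝒳) (f : 𝒳 → ℝ) : Measure 𝒳 :=
  μ.withDensity fun x => ENNReal.ofReal (f x)

/-- The root density `√f`, as a vector of `L²(μ)`. -/
noncomputable def rootDensity (μ : Measure 𝒳) (f : 𝒳 → ℝ) : Lp ℝ 2 μ :=
  toL2 μ fun x => √(f x)

lemma IsDensityFamily.isDensity {d : ℕ} {Θ : Set (EuclideanSpace ℝ (Fin d))}
    {p : EuclideanSpace ℝ (Fin d) → 𝒳 → ℝ} {θ : EuclideanSpace ℝ (Fin d)}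
    (hp : IsDensityFamily μ Θ p) (hθ : θ ∈ Θ) : IsDensity μ (p θ) :=
  ⟨hp.measurable θ hθ, hp.nonneg θ hθ, hp.lintegral_eq_one θ hθ⟩

namespace IsDensity

lemma memLp_sqrt (hf : IsDensity μ f) : MemLp (fun x => √(f x)) 2 μ := by
  refine (memLp_two_iff_integrable_sq hf.measurable.sqrt.aestronglyMeasurable).2 ?_
  simp only [Real.sq_sqrt (hf.nonneg _)]
  refine ⟨hf.measurable.aestronglyMeasurable, ?_⟩
  rw [hasFiniteIntegral_iff_ofReal (.of_forall hf.nonneg), hf.lintegral_eq_one]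
  exact ENNReal.one_lt_top

lemma norm_rootDensity (hf : IsDensity μ f) : ‖rootDensity μ f‖ = 1 := by
  have hsq : ‖rootDensity μ f‖ ^ 2 = 1 := by
    rw [rootDensity, norm_toL2_sq hf.memLp_sqrt]
    simp only [Real.sq_sqrt (hf.nonneg _)]
    rw [integral_eq_lintegral_of_nonneg_ae (.of_forall hf.nonneg)
      hf.measurable.aestronglyMeasurable, hf.lintegral_eq_one, ENNReal.toReal_one]
  exact (pow_eq_one_iff_of_nonneg (norm_nonneg _) two_ne_zero).1 hsq

lemma isProbabilityMeasure (hf : IsDensity μ f) : IsProbabilityMeasure (densityLaw μ f) :=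
  ⟨by rw [densityLaw, withDensity_apply _ .univ, Measure.restrict_univ, hf.lintegral_eq_one]⟩

lemma integral_densityLaw (hf : IsDensity μ f) (g : 𝒳 → ℝ) :
    ∫ x, g x ∂(densityLaw μ f) = ∫ x, g x * √(f x) * √(f x) ∂μ := by
  rw [densityLaw, integral_withDensity_eq_integral_toReal_smul hf.measurable.ennreal_ofReal
    (.of_forall fun _ => ENNReal.ofReal_lt_top)]
  refine integral_congr_ae (.of_forall fun x => ?_)
  simp only [ENNReal.toReal_ofReal (hf.nonneg x), smul_eq_mul, mul_assoc,
    Real.mul_self_sqrt (hf.nonneg x), mul_comm (f x)]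

lemma integral_sq_densityLaw (hf : IsDensity μ f) (g : 𝒳 → ℝ) :
    ∫ x, g x ^ 2 ∂(densityLaw μ f) = ∫ x, (g x * √(f x)) ^ 2 ∂μ := by
  rw [hf.integral_densityLaw]
  exact integral_congr_ae (.of_forall fun x => by ring)

lemma memLp_densityLaw_iff (hf : IsDensity μ f) (hg : Measurable g) :
    MemLp g 2 (densityLaw μ f) ↔ MemLp (fun x => g x * √(f x)) 2 μ := by
  have hgf : Measurable fun x => g x * √(f x) := hg.mul hf.measurable.sqrt
  rw [memLp_two_iff_integrable_sq hg.aestronglyMeasurable,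
    memLp_two_iff_integrable_sq hgf.aestronglyMeasurable, densityLaw,
    integrable_withDensity_iff_integrable_smul' hf.measurable.ennreal_ofReal
      (.of_forall fun _ => ENNReal.ofReal_lt_top)]
  simp only [mul_pow, ENNReal.toReal_ofReal (hf.nonneg _), Real.sq_sqrt (hf.nonneg _),
    smul_eq_mul, mul_comm]

lemma integral_densityLaw_eq_inner (hf : IsDensity μ f)
    (hg : MemLp (fun x => g x * √(f x)) 2 μ) :
    ∫ x, g x ∂(densityLaw μ f) = inner ℝ (toL2 μ fun x => g x * √(f x)) (rootDensity μ f) := by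
  rw [rootDensity, inner_toL2 hg hf.memLp_sqrt, hf.integral_densityLaw]

lemma memLp_sqrt_sub (hf : IsDensity μ f) (hg : IsDensity μ g) :
    MemLp (fun x => √(f x) - √(g x)) 2 μ :=
  hf.memLp_sqrt.sub hg.memLp_sqrt

lemma rootDensity_sub (hf : IsDensity μ f) (hg : IsDensity μ g) :
    rootDensity μ f - rootDensity μ g = toL2 μ fun x => √(f x) - √(g x) :=
  (toL2_sub hf.memLp_sqrt hg.memLp_sqrt).symm

end IsDensity

end Densities

section Scores

variable {𝒳 : Type*} [MeasurableSpace 𝒳] {d : ℕ} {μ : Measure 𝒳}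
  {Θ : Set (EuclideanSpace ℝ (Fin d))} {p : EuclideanSpace ℝ (Fin d) → 𝒳 → ℝ}
  {s : 𝒳 → EuclideanSpace ℝ (Fin d)}
  {score : EuclideanSpace ℝ (Fin d) → 𝒳 → EuclideanSpace ℝ (Fin d)}
  {θ θ₀ θ₁ : EuclideanSpace ℝ (Fin d)}

/-- The linear map `k ↦ ½ kᵀ s √f` into `L²(μ)`: when `s` is the score of a family at the density
`f`, it is the derivative there of the root density. By convention it is `0` when some
`kᵀ s √f` is not square integrable. -/
noncomputable def rootScore (μ : Measure 𝒳) (f : 𝒳 → ℝ) (s : 𝒳 → EuclideanSpace ℝ (Fin d)) :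
    EuclideanSpace ℝ (Fin d) →L[ℝ] Lp ℝ 2 μ :=
  open Classical in
  if hs : ∀ k, MemLp (fun x => inner ℝ k (s x) * √(f x)) 2 μ then
    LinearMap.toContinuousLinearMap
      { toFun := fun k => (1 / 2 : ℝ) • toL2 μ fun x => inner ℝ k (s x) * √(f x)
        map_add' := fun k k' => by
          simp only [inner_add_left, add_mul, toL2_add (hs k) (hs k'), smul_add]
        map_smul' := fun c k => by
          simp only [real_inner_smul_left, mul_assoc, toL2_const_mul c (hs k), RingHom.id_apply,
            smul_comm c] }
  else 0

lemma rootScore_apply {f : 𝒳 → ℝ} (hs : ∀ k, MemLp (fun x => inner ℝ k (s x) * √(f x)) 2 μ)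
    (k : EuclideanSpace ℝ (Fin d)) :
    rootScore μ f s k = (1 / 2 : ℝ) • toL2 μ fun x => inner ℝ k (s x) * √(f x) := by
  rw [rootScore, dif_pos hs]
  rfl

lemma two_smul_rootScore {f : 𝒳 → ℝ} (hs : ∀ k, MemLp (fun x => inner ℝ k (s x) * √(f x)) 2 μ)
    (k : EuclideanSpace ℝ (Fin d)) :
    (2 : ℝ) • rootScore μ f s k = toL2 μ fun x => inner ℝ k (s x) * √(f x) := by
  rw [rootScore_apply hs, smul_smul]
  norm_num

lemma measurable_rootRemainder (h₀ : IsDensity μ (p θ₀)) (h₁ : IsDensity μ (p θ₁))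
    (hs : Measurable s) : Measurable (rootRemainder p s θ₀ θ₁) :=
  (h₁.measurable.sqrt.sub h₀.measurable.sqrt).sub
    (((measurable_const.inner hs).const_mul _).mul h₀.measurable.sqrt)

lemma integral_rootRemainder_sq (h₀ : IsDensity μ (p θ₀)) (h₁ : IsDensity μ (p θ₁))
    (hs : ∀ k, MemLp (fun x => inner ℝ k (s x) * √(p θ₀ x)) 2 μ) :
    ∫ x, rootRemainder p s θ₀ θ₁ x ^ 2 ∂μ
      = ‖rootDensity μ (p θ₁) - rootDensity μ (p θ₀) - rootScore μ (p θ₀) s (θ₁ - θ₀)‖ ^ 2 := by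
  rw [rootScore_apply hs, ← toL2_const_mul _ (hs _), h₁.rootDensity_sub h₀,
    norm_toL2_sub_sq (h₁.memLp_sqrt_sub h₀) ((hs _).const_mul _)]
  simp only [rootRemainder, mul_assoc]

lemma HasDQMScore.memLp_inner (hD : HasDQMScore μ p s θ)
    (hp : ∀ᶠ θ' in 𝓝 θ, IsDensity μ (p θ')) (hs : Measurable s)
    (k : EuclideanSpace ℝ (Fin d)) : MemLp (fun x => inner ℝ k (s x) * √(p θ x)) 2 μ := by
  have ht : Tendsto (fun t : ℝ => t • k) (𝓝[≠] 0) (𝓝 0) :=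
    tendsto_nhdsWithin_of_tendsto_nhds
      (by simpa using (tendsto_id (α := ℝ) (x := 𝓝 0)).smul_const k)
  have hadd : Tendsto (fun t : ℝ => θ + t • k) (𝓝[≠] 0) (𝓝 θ) := by simpa using ht.const_add θ
  obtain ⟨t, ⟨hint, hpt⟩, ht0⟩ := (((ht.eventually hD.1).and (hadd.eventually hp)).and
    self_mem_nhdsWithin).exists
  have hθ := hp.self_of_nhds
  have hR := (memLp_two_iff_integrable_sq
    (measurable_rootRemainder hθ hpt hs).aestronglyMeasurable).2 hint
  refine (((hpt.memLp_sqrt.sub hθ.memLp_sqrt).sub hR).const_mul (2 / t)).ae_eq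
    (.of_forall fun x => ?_)
  have ht0 : t ≠ 0 := ht0
  simp only [Pi.sub_apply, rootRemainder, add_sub_cancel_left, real_inner_smul_left]
  field_simp
  ring

lemma HasDQMScore.hasFDerivAt (hD : HasDQMScore μ p s θ)
    (hp : ∀ᶠ θ' in 𝓝 θ, IsDensity μ (p θ')) (hs : Measurable s) :
    HasFDerivAt (fun θ' => rootDensity μ (p θ')) (rootScore μ (p θ) s) θ := by
  refine hasFDerivAt_iff_isLittleO_nhds_zero.2 (isLittleO_of_norm_sq (hD.2.congr' ?_ .rfl))
  have hadd : Tendsto (fun h => θ + h) (𝓝 0) (𝓝 θ) := by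
    simpa using (continuous_const_add θ).tendsto 0
  filter_upwards [hadd.eventually hp] with h hh
  rw [integral_rootRemainder_sq hp.self_of_nhds hh (hD.memLp_inner hp hs), add_sub_cancel_left]

lemma IsDDQM.isLittleO_rootDensity (hDD : IsDDQM μ p score θ)
    (hD : ∀ᶠ θ' in 𝓝 θ, HasDQMScore μ p (score θ') θ') (hp : ∀ᶠ θ' in 𝓝 θ, IsDensity μ (p θ'))
    (hs : ∀ᶠ θ' in 𝓝 θ, Measurable (score θ')) {a b : ℕ → EuclideanSpace ℝ (Fin d)}
    (ha : Tendsto a atTop (𝓝 θ)) (hb : Tendsto b atTop (𝓝 θ)) :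
    (fun n => rootDensity μ (p (a n)) - rootDensity μ (p (b n))
      - rootScore μ (p (b n)) (score (b n)) (a n - b n)) =o[atTop] fun n => a n - b n := by
  have hexp := (hDD (fun n => a n - θ) (fun n => b n - θ) (tendsto_sub_nhds_zero_iff.2 ha)
    (tendsto_sub_nhds_zero_iff.2 hb)).2
  simp only [add_sub_cancel, sub_sub_sub_cancel_right] at hexp
  refine isLittleO_of_norm_sq (hexp.congr' ?_ .rfl)
  filter_upwards [ha.eventually hp, hb.eventually hp.eventually_nhds, hb.eventually hD,
    hb.eventually hs] with n hpa hpb hDb hsb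
  rw [integral_rootRemainder_sq hpb.self_of_nhds hpa (hDb.memLp_inner hpb hsb)]

/- The root densities are unit vectors, and the derivative of a map into the unit sphere is
orthogonal to the map. -/
lemma HasDQMScore.integral_inner_score (hD : HasDQMScore μ p s θ)
    (hp : ∀ᶠ θ' in 𝓝 θ, IsDensity μ (p θ')) (hs : Measurable s)
    (k : EuclideanSpace ℝ (Fin d)) :
    ∫ x, inner ℝ k (s x) ∂(densityLaw μ (p θ)) = 0 := by
  have hderiv := (hD.hasFDerivAt hp hs).norm_sq
  have hconst : HasFDerivAt (fun θ' => ‖rootDensity μ (p θ')‖ ^ 2)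
      (0 : EuclideanSpace ℝ (Fin d) →L[ℝ] ℝ) θ :=
    (hasFDerivAt_const (1 : ℝ) θ).congr_of_eventuallyEq
      (hp.mono fun θ' hθ' => by simp [hθ'.norm_rootDensity])
  have horth := congrArg (fun T => T k) (hderiv.unique hconst)
  have hmem := hD.memLp_inner hp hs
  rw [hp.self_of_nhds.integral_densityLaw_eq_inner (hmem k), real_inner_comm]
  simpa [rootScore_apply hmem, real_inner_smul_right] using horth

lemma quadForm_fisherInfo (hp : IsDensity μ (p θ)) (hs : Measurable (score θ))
    (hmem : ∀ k, MemLp (fun x => inner ℝ k (score θ x) * √(p θ x)) 2 μ)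
    (k : EuclideanSpace ℝ (Fin d)) :
    quadForm (fisherInfo μ p score θ) k
      = ‖toL2 μ fun x => inner ℝ k (score θ x) * √(p θ x)‖ ^ 2 := by
  have hcoord (i : Fin d) : MemLp (fun x => score θ x i) 2 (law μ p θ) := by
    have hmeas : Measurable fun x => score θ x i :=
      (EuclideanSpace.proj (𝕜 := ℝ) i).measurable.comp hs
    refine (hp.memLp_densityLaw_iff hmeas).2 ?_
    simpa only [EuclideanSpace.inner_single_left, map_one, one_mul]
      using hmem (EuclideanSpace.single i 1)
  have hint (i j : Fin d) :
      Integrable (fun x => k i * k j * (score θ x i * score θ x j)) (law μ p θ) :=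
    ((hcoord i).integrable_mul (hcoord j)).const_mul _
  have hexpand (x : 𝒳) : inner ℝ k (score θ x) ^ 2
      = ∑ i, ∑ j, k i * k j * (score θ x i * score θ x j) := by
    rw [PiLp.inner_apply, pow_two, Finset.sum_mul_sum]
    refine Finset.sum_congr rfl fun i _ => Finset.sum_congr rfl fun j _ => ?_
    simp only [RCLike.inner_apply, conj_trivial]
    ring
  calc quadForm (fisherInfo μ p score θ) k
      = ∑ i, ∑ j, ∫ x, k i * k j * (score θ x i * score θ x j) ∂(law μ p θ) := by
        simp only [quadForm, dotProduct, Matrix.mulVec, fisherInfo, Matrix.of_apply,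
          Finset.mul_sum, integral_const_mul]
        exact Finset.sum_congr rfl fun i _ => Finset.sum_congr rfl fun j _ => by ring
    _ = ∫ x, inner ℝ k (score θ x) ^ 2 ∂(law μ p θ) := by
        simp only [hexpand]
        rw [integral_finsetSum _ fun i _ => integrable_finsetSum _ fun j _ => hint i j]
        exact Finset.sum_congr rfl fun i _ => (integral_finsetSum _ fun j _ => hint i j).symm
    _ = ‖toL2 μ fun x => inner ℝ k (score θ x) * √(p θ x)‖ ^ 2 := by
        rw [norm_toL2_sq (hmem k)]
        exact hp.integral_sq_densityLaw _

end Scores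

section RootIncrements

variable {𝒳 : Type*} {f₀ f₁ : 𝒳 → ℝ} {x : 𝒳}

/-- The relative increment `2 (√(f₁ / f₀) - 1)` of the root density from `f₀` to `f₁`. Division
by zero makes it `-2` where `f₀` vanishes, a null set for the law with density `f₀`. -/
noncomputable def rootIncrement (f₀ f₁ : 𝒳 → ℝ) (x : 𝒳) : ℝ :=
  2 * (√(f₁ x) / √(f₀ x) - 1)

lemma rootIncrement_mul_sqrt (hx : √(f₀ x) ≠ 0) :
    rootIncrement f₀ f₁ x * √(f₀ x) = 2 * (√(f₁ x) - √(f₀ x)) := by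
  rw [rootIncrement]
  field_simp

lemma pos_of_abs_rootIncrement_le_one (hx : |rootIncrement f₀ f₁ x| ≤ 1) :
    0 < f₀ x ∧ 0 < f₁ x := by
  refine ⟨Real.sqrt_ne_zero'.1 fun h => ?_, Real.sqrt_ne_zero'.1 fun h => ?_⟩ <;>
  · rw [rootIncrement, h] at hx
    norm_num at hx

lemma two_mul_log_one_add_rootIncrement (h₀ : 0 < f₀ x) (h₁ : 0 < f₁ x) :
    2 * Real.log (1 + rootIncrement f₀ f₁ x / 2) = Real.log (f₁ x) - Real.log (f₀ x) := by
  have hratio : 1 + rootIncrement f₀ f₁ x / 2 = √(f₁ x) / √(f₀ x) := by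
    rw [rootIncrement]
    ring
  rw [hratio, Real.log_div (Real.sqrt_ne_zero'.2 h₁) (Real.sqrt_ne_zero'.2 h₀),
    Real.log_sqrt h₀.le, Real.log_sqrt h₁.le]
  ring

variable [MeasurableSpace 𝒳] {μ : Measure 𝒳}

lemma measurable_rootIncrement (h₀ : Measurable f₀) (h₁ : Measurable f₁) :
    Measurable (rootIncrement f₀ f₁) :=
  ((h₁.sqrt.div h₀.sqrt).sub_const 1).const_mul 2

lemma memLp_rootIncrement (h₀ : IsDensity μ f₀) (h₁ : IsDensity μ f₁) :
    MemLp (rootIncrement f₀ f₁) 2 (densityLaw μ f₀) := by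
  have hmeas := measurable_rootIncrement h₀.measurable h₁.measurable
  rw [h₀.memLp_densityLaw_iff hmeas]
  refine ((h₁.memLp_sqrt_sub h₀).const_mul 2).mono
    (hmeas.mul h₀.measurable.sqrt).aestronglyMeasurable (.of_forall fun x => ?_)
  by_cases hx : √(f₀ x) = 0
  · simp [hx]
  · rw [rootIncrement_mul_sqrt hx]

lemma integral_rootIncrement (h₀ : IsDensity μ f₀) (h₁ : IsDensity μ f₁) :
    ∫ x, rootIncrement f₀ f₁ x ∂(densityLaw μ f₀)
      = -‖rootDensity μ f₁ - rootDensity μ f₀‖ ^ 2 := by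
  have hunit : -‖rootDensity μ f₁ - rootDensity μ f₀‖ ^ 2
      = 2 * inner ℝ (rootDensity μ f₁ - rootDensity μ f₀) (rootDensity μ f₀) := by
    rw [norm_sub_sq_real, inner_sub_left, real_inner_self_eq_norm_sq, h₀.norm_rootDensity,
      h₁.norm_rootDensity]
    ring
  rw [hunit, h₁.rootDensity_sub h₀, rootDensity, inner_toL2 (h₁.memLp_sqrt_sub h₀) h₀.memLp_sqrt,
    h₀.integral_densityLaw, ← integral_const_mul]
  refine integral_congr_ae (.of_forall fun x => ?_)
  by_cases hx : √(f₀ x) = 0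
  · simp [hx]
  · simp only [rootIncrement_mul_sqrt hx, mul_assoc]

lemma integral_smul_rootIncrement_sub_sq_le (h₀ : IsDensity μ f₀) (h₁ : IsDensity μ f₁)
    {g : 𝒳 → ℝ} (hg : MemLp (fun x => g x * √(f₀ x)) 2 μ) (c : ℝ) :
    ∫ x, (c * rootIncrement f₀ f₁ x - g x) ^ 2 ∂(densityLaw μ f₀)
      ≤ ‖(2 * c) • (rootDensity μ f₁ - rootDensity μ f₀) - toL2 μ fun x => g x * √(f₀ x)‖ ^ 2 := by
  have hdiff := (h₁.memLp_sqrt_sub h₀).const_mul (2 * c)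
  rw [h₁.rootDensity_sub h₀, ← toL2_const_mul _ (h₁.memLp_sqrt_sub h₀), norm_toL2_sub_sq hdiff hg,
    h₀.integral_sq_densityLaw]
  refine integral_mono_of_nonneg (.of_forall fun x => sq_nonneg _) (hdiff.sub hg).integrable_sq
    (.of_forall fun x => ?_)
  by_cases hx : √(f₀ x) = 0
  · simp only [hx, mul_zero, ne_eq, OfNat.ofNat_ne_zero, not_false_eq_true, zero_pow]
    exact sq_nonneg _
  · refine le_of_eq (congrArg (· ^ 2) ?_)
    linear_combination c * rootIncrement_mul_sqrt (f₁ := f₁) hx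

end RootIncrements

section LindebergArrays

variable {α : Type*} [MeasurableSpace α] {Q : ℕ → Measure α} {v w : ℕ → α → ℝ} {σ2 : ℝ}

/-- Row `n` of a triangular array consists of `n` independent copies of `v n`, each under `Q n`.
The array satisfies the Lindeberg condition with limiting total second moment `σ2`: the row totals
of the second moments tend to `σ2`, and large values do not contribute to them in the limit. -/
structure IsLindebergArray (Q : ℕ → Measure α) (v : ℕ → α → ℝ) (σ2 : ℝ) : Prop where
  measurable : ∀ n, Measurable (v n)
  memLp : ∀ᶠ n in atTop, MemLp (v n) 2 (Q n)
  tendsto_sq : Tendsto (fun n : ℕ => n * ∫ x, v n x ^ 2 ∂(Q n)) atTop (𝓝 σ2)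
  tendsto_tail : ∀ ε : ℝ, 0 < ε →
    Tendsto (fun n : ℕ => n * ∫ x in {x | ε < |v n x|}, v n x ^ 2 ∂(Q n)) atTop (𝓝 0)

lemma measurableSet_lt_abs {u : α → ℝ} (hu : Measurable u) (ε : ℝ) :
    MeasurableSet {x | ε < |u x|} :=
  measurableSet_lt measurable_const hu.abs

lemma mul_measureReal_lt_abs_le {ν : Measure α} {u : α → ℝ} (hu : Measurable u)
    (hu2 : MemLp u 2 ν) {ε : ℝ} (hε : 0 < ε) :
    ε ^ 2 * ν.real {x | ε < |u x|} ≤ ∫ x in {x | ε < |u x|}, u x ^ 2 ∂ν := by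
  have hsq (x : α) (hx : ε < |u x|) : ε ^ 2 ≤ u x ^ 2 := by
    rw [← sq_abs (u x)]
    exact pow_le_pow_left₀ hε.le hx.le 2
  have hmeas := measurableSet_lt_abs hu ε
  have hfin : ν {x | ε < |u x|} ≠ ⊤ := by
    refine ((measure_mono fun x hx => ?_).trans_lt
      (hu2.integrable_sq.measure_ge_lt_top (pow_pos hε 2))).ne
    exact hsq x hx
  simpa [mul_comm] using setIntegral_mono_on (integrableOn_const hfin)
    hu2.integrable_sq.integrableOn hmeas hsq

lemma indicator_lt_abs_sq_le {β : Type*} (u u' : β → ℝ) (ε : ℝ) (x : β) :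
    {x | ε < |u' x|}.indicator (fun x => u' x ^ 2) x
      ≤ 4 * (u' x - u x) ^ 2 + 2 * {x | ε / 2 < |u x|}.indicator (fun x => u x ^ 2) x := by
  simp only [Set.indicator_apply, Set.mem_ofPred_eq]
  split_ifs with hu' hu hu
  · nlinarith [sq_nonneg (u' x - 2 * u x)]
  · have hhalf : |u' x| / 2 ≤ |u' x - u x| := by linarith [abs_sub_abs_le_abs_sub (u' x) (u x)]
    have hsq := pow_le_pow_left₀ (by positivity) hhalf 2
    rw [div_pow, sq_abs, sq_abs] at hsq
    linarith
  all_goals positivity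

namespace IsLindebergArray

lemma tendsto_nat_mul_measureReal (hv : IsLindebergArray Q v σ2) {ε : ℝ} (hε : 0 < ε) :
    Tendsto (fun n : ℕ => n * (Q n).real {x | ε < |v n x|}) atTop (𝓝 0) := by
  have hlim := (hv.tendsto_tail ε hε).const_mul (ε ^ 2)⁻¹
  rw [mul_zero] at hlim
  refine squeeze_zero' (.of_forall fun n => by positivity) ?_ hlim
  filter_upwards [hv.memLp] with n hn
  rw [inv_mul_eq_div, le_div_iff₀ (pow_pos hε 2), mul_assoc]
  refine mul_le_mul_of_nonneg_left ?_ n.cast_nonneg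
  rw [mul_comm]
  exact mul_measureReal_lt_abs_le (hv.measurable n) hn hε

variable {E : Type*} [NormedAddCommGroup E] [NormedSpace ℝ E] {F : ℝ → E} {A : E} {C : ℝ}

lemma tendsto_nat_smul_integral_of_isLittleO (hv : IsLindebergArray Q v σ2)
    (hbound : ∀ w, ‖F w‖ ≤ C * w ^ 2) (hlittle : F =o[𝓝 0] fun w => w ^ 2) :
    Tendsto (fun n : ℕ => (n : ℝ) • ∫ x, F (v n x) ∂(Q n)) atTop (𝓝 0) := by
  rw [Metric.tendsto_nhds]
  intro ε hε
  obtain ⟨η, hη, hηε⟩ : ∃ η : ℝ, 0 < η ∧ η * σ2 + C * 0 < ε := by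
    refine ⟨ε / (|σ2| + 1), by positivity, ?_⟩
    rw [mul_zero, add_zero, div_mul_eq_mul_div, div_lt_iff₀ (by positivity)]
    exact mul_lt_mul_of_pos_left (lt_of_le_of_lt (le_abs_self σ2) (lt_add_one _)) hε
  obtain ⟨δ, hδ, hsmall⟩ := Metric.eventually_nhds_iff.1 (hlittle.def hη)
  have hpoint (y : ℝ) : ‖F y‖ ≤ η * y ^ 2 + C * {y : ℝ | δ / 2 < |y|}.indicator (· ^ 2) y := by
    simp only [Set.indicator_apply, Set.mem_ofPred_eq]
    split_ifs with hy
    · exact (hbound y).trans (le_add_of_nonneg_left (by positivity))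
    · simpa using hsmall (y := y) (by rw [Real.dist_0_eq_abs]; linarith)
  have hlim := ((hv.tendsto_sq.const_mul η).add
    ((hv.tendsto_tail (δ / 2) (half_pos hδ)).const_mul C)).eventually_lt_const hηε
  filter_upwards [hlim, hv.memLp] with n hn hmem
  have hsq := hmem.integrable_sq
  have hmeas := measurableSet_lt_abs (hv.measurable n) (δ / 2)
  rw [dist_zero_right, norm_smul, Real.norm_natCast]
  refine lt_of_le_of_lt ?_ hn
  calc n * ‖∫ x, F (v n x) ∂(Q n)‖
      ≤ n * ∫ x, (η * v n x ^ 2 + C * {x | δ / 2 < |v n x|}.indicator (fun x => v n x ^ 2) x)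
          ∂(Q n) :=
        mul_le_mul_of_nonneg_left (norm_integral_le_of_norm_le
          ((hsq.const_mul η).add ((hsq.indicator hmeas).const_mul C))
          (.of_forall fun x => hpoint (v n x))) n.cast_nonneg
    _ = η * (n * ∫ x, v n x ^ 2 ∂(Q n))
          + C * (n * ∫ x in {x | δ / 2 < |v n x|}, v n x ^ 2 ∂(Q n)) := by
        rw [integral_add (hsq.const_mul η) ((hsq.indicator hmeas).const_mul C),
          integral_const_mul, integral_const_mul, integral_indicator hmeas]
        ring

lemma tendsto_nat_smul_integral_comp [CompleteSpace E] (hv : IsLindebergArray Q v σ2)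
    (hF : StronglyMeasurable F) (hbound : ∀ w, ‖F w‖ ≤ C * w ^ 2)
    (hlittle : (fun w => F w - w ^ 2 • A) =o[𝓝 0] fun w => w ^ 2) :
    Tendsto (fun n : ℕ => (n : ℝ) • ∫ x, F (v n x) ∂(Q n)) atTop (𝓝 (σ2 • A)) := by
  have hbound' (w : ℝ) : ‖F w - w ^ 2 • A‖ ≤ (C + ‖A‖) * w ^ 2 := by
    refine (norm_sub_le _ _).trans ?_
    rw [norm_smul, Real.norm_of_nonneg (sq_nonneg w), add_mul, mul_comm ‖A‖]
    exact add_le_add_left (hbound w) _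
  have hlim := (hv.tendsto_nat_smul_integral_of_isLittleO hbound' hlittle).add
    (hv.tendsto_sq.smul_const A)
  rw [zero_add] at hlim
  refine hlim.congr' ?_
  filter_upwards [hv.memLp] with n hn
  have hFint : Integrable (fun x => F (v n x)) (Q n) :=
    (hn.integrable_sq.const_mul C).mono' (hF.comp_measurable (hv.measurable n)).aestronglyMeasurable
      (.of_forall fun x => hbound _)
  rw [integral_sub hFint (hn.integrable_sq.smul_const A), integral_smul_const]
  module

lemma tendsto_sq_of_sub (hv : IsLindebergArray Q v σ2)
    (hw : ∀ᶠ n in atTop, MemLp (w n) 2 (Q n))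
    (hwv : Tendsto (fun n : ℕ => n * ∫ x, (w n x - v n x) ^ 2 ∂(Q n)) atTop (𝓝 0)) :
    Tendsto (fun n : ℕ => n * ∫ x, w n x ^ 2 ∂(Q n)) atTop (𝓝 σ2) := by
  have hdiff : Tendsto (fun n : ℕ => √(n * ∫ x, w n x ^ 2 ∂(Q n)) - √(n * ∫ x, v n x ^ 2 ∂(Q n)))
      atTop (𝓝 0) := by
    refine squeeze_zero_norm' ?_ (by simpa using hwv.sqrt)
    filter_upwards [hv.memLp, hw] with n hvn hwn
    rw [← norm_toL2_sq hwn, ← norm_toL2_sq hvn, ← norm_toL2_sub_sq hwn hvn]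
    simp only [Real.sqrt_mul n.cast_nonneg, Real.sqrt_sq (norm_nonneg _), ← mul_sub, norm_mul]
    rw [Real.norm_of_nonneg (Real.sqrt_nonneg _)]
    exact mul_le_mul_of_nonneg_left (abs_norm_sub_norm_le _ _) (Real.sqrt_nonneg _)
  have hnonneg (u : ℕ → α → ℝ) (n : ℕ) : 0 ≤ n * ∫ x, u n x ^ 2 ∂(Q n) :=
    mul_nonneg n.cast_nonneg (integral_nonneg fun x => sq_nonneg _)
  have hsqrt := (hdiff.add hv.tendsto_sq.sqrt).pow 2
  simpa only [sub_add_cancel, zero_add, Real.sq_sqrt (hnonneg w _),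
    Real.sq_sqrt (ge_of_tendsto' hv.tendsto_sq (hnonneg v))] using hsqrt

lemma of_sub (hv : IsLindebergArray Q v σ2) (hmeas : ∀ n, Measurable (w n))
    (hw : ∀ᶠ n in atTop, MemLp (w n) 2 (Q n))
    (hwv : Tendsto (fun n : ℕ => n * ∫ x, (w n x - v n x) ^ 2 ∂(Q n)) atTop (𝓝 0)) :
    IsLindebergArray Q w σ2 where
  measurable := hmeas
  memLp := hw
  tendsto_sq := hv.tendsto_sq_of_sub hw hwv
  tendsto_tail ε hε := by
    have hlim := (hwv.const_mul 4).add ((hv.tendsto_tail (ε / 2) (half_pos hε)).const_mul 2)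
    rw [mul_zero, mul_zero, add_zero] at hlim
    refine squeeze_zero' (.of_forall fun n => mul_nonneg n.cast_nonneg
      (integral_nonneg fun x => sq_nonneg _)) ?_ hlim
    filter_upwards [hv.memLp, hw] with n hvn hwn
    have hS := measurableSet_lt_abs (hmeas n) ε
    have hT := measurableSet_lt_abs (hv.measurable n) (ε / 2)
    have hint : Integrable (fun x => 4 * (w n x - v n x) ^ 2) (Q n) :=
      (hwn.sub hvn).integrable_sq.const_mul 4
    have hint' := (hvn.integrable_sq.indicator hT).const_mul 2
    have hmono := integral_mono (hwn.integrable_sq.indicator hS) (hint.add hint')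
      fun x => indicator_lt_abs_sq_le (v n) (w n) ε x
    rw [integral_indicator hS] at hmono
    calc n * ∫ x in {x | ε < |w n x|}, w n x ^ 2 ∂(Q n)
        ≤ n * ∫ x, (4 * (w n x - v n x) ^ 2
          + 2 * {x | ε / 2 < |v n x|}.indicator (fun x => v n x ^ 2) x) ∂(Q n) :=
          mul_le_mul_of_nonneg_left hmono n.cast_nonneg
      _ = _ := by
          rw [integral_add hint hint', integral_const_mul, integral_const_mul,
            integral_indicator hT]
          ring

end IsLindebergArray

end LindebergArrays

section SquareIntegrableTails

variable {α : Type*} [MeasurableSpace α] {μ : Measure α}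

lemma setIntegral_sq_le {u v : α → ℝ} (hu : MemLp u 2 μ) (hv : MemLp v 2 μ) (S : Set α) :
    ∫ x in S, u x ^ 2 ∂μ ≤ 2 * ‖toL2 μ u - toL2 μ v‖ ^ 2 + 2 * ∫ x in S, v x ^ 2 ∂μ := by
  have huv : Integrable (fun x => 2 * (u x - v x) ^ 2) μ := (hu.sub hv).integrable_sq.const_mul 2
  have hv2 := hv.integrable_sq.const_mul 2
  calc ∫ x in S, u x ^ 2 ∂μ
      ≤ ∫ x in S, (2 * (u x - v x) ^ 2 + 2 * v x ^ 2) ∂μ :=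
        setIntegral_mono hu.integrable_sq.integrableOn (huv.add hv2).integrableOn
          fun x => by simp only; nlinarith [sq_nonneg (u x - 2 * v x)]
    _ = ∫ x in S, 2 * (u x - v x) ^ 2 ∂μ + 2 * ∫ x in S, v x ^ 2 ∂μ := by
        rw [integral_add huv.integrableOn hv2.integrableOn, integral_const_mul 2 fun x => v x ^ 2]
    _ ≤ 2 * ‖toL2 μ u - toL2 μ v‖ ^ 2 + 2 * ∫ x in S, v x ^ 2 ∂μ := by
        rw [norm_toL2_sub_sq hu hv, ← integral_const_mul 2 fun x => (u x - v x) ^ 2]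
        exact add_le_add_left (setIntegral_le_integral huv (.of_forall fun x => by positivity)) _

lemma tendsto_setIntegral_sq_of_sub {ι : Type*} {l : Filter ι} {u v : ι → α → ℝ}
    (hu : ∀ᶠ i in l, MemLp (u i) 2 μ) (hv : ∀ᶠ i in l, MemLp (v i) 2 μ)
    (huv : Tendsto (fun i => toL2 μ (u i) - toL2 μ (v i)) l (𝓝 0)) {S : ι → Set α}
    (hS : Tendsto (fun i => ∫ x in S i, v i x ^ 2 ∂μ) l (𝓝 0)) :
    Tendsto (fun i => ∫ x in S i, u i x ^ 2 ∂μ) l (𝓝 0) := by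
  have hlim := ((huv.norm.pow 2).const_mul 2).add (hS.const_mul 2)
  simp only [norm_zero, ne_eq, OfNat.ofNat_ne_zero, not_false_eq_true, zero_pow, mul_zero,
    add_zero] at hlim
  refine squeeze_zero' (.of_forall fun i => integral_nonneg fun x => sq_nonneg _) ?_ hlim
  filter_upwards [hu, hv] with i hui hvi using setIntegral_sq_le hui hvi (S i)

end SquareIntegrableTails

section ScaledArrays

variable {𝒳 : Type*} [MeasurableSpace 𝒳] {μ : Measure 𝒳} {f : ℕ → 𝒳 → ℝ} {f₀ : 𝒳 → ℝ}
  {G : ℕ → 𝒳 → ℝ} {G₀ : 𝒳 → ℝ}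

lemma IsDensity.setIntegral_sq_densityLaw {g : 𝒳 → ℝ} (hg : IsDensity μ g) (u : 𝒳 → ℝ) {S : Set 𝒳}
    (hS : MeasurableSet S) :
    ∫ x in S, u x ^ 2 ∂(densityLaw μ g) = ∫ x in S, (u x * √(g x)) ^ 2 ∂μ := by
  rw [← integral_indicator hS, hg.integral_densityLaw, ← integral_indicator hS]
  refine integral_congr_ae (.of_forall fun x => ?_)
  by_cases hx : x ∈ S <;> simp [hx]
  ring

lemma IsDensity.measureReal_densityLaw {g : 𝒳 → ℝ} (hg : IsDensity μ g) {S : Set 𝒳}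
    (hS : MeasurableSet S) : (densityLaw μ g).real S = ∫ x in S, √(g x) ^ 2 ∂μ := by
  simpa using hg.setIntegral_sq_densityLaw (fun _ => 1) hS

/- Under the varying laws the integrals over `S n` are compared with those under the fixed law with
density `f₀`, where absolute continuity of the integral applies. -/
lemma tendsto_setIntegral_sq_densityLaw (hf : ∀ n, IsDensity μ (f n)) (hf₀ : IsDensity μ f₀)
    (hff₀ : Tendsto (fun n => rootDensity μ (f n)) atTop (𝓝 (rootDensity μ f₀)))
    (hG : ∀ᶠ n in atTop, MemLp (fun x => G n x * √(f n x)) 2 μ)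
    (hG₀ : Measurable G₀) (hG₀' : MemLp (fun x => G₀ x * √(f₀ x)) 2 μ)
    (hGG₀ : Tendsto (fun n => toL2 μ fun x => G n x * √(f n x)) atTop
      (𝓝 (toL2 μ fun x => G₀ x * √(f₀ x))))
    {S : ℕ → Set 𝒳} (hS : ∀ n, MeasurableSet (S n))
    (hSlim : Tendsto (fun n => (densityLaw μ (f n)).real (S n)) atTop (𝓝 0)) :
    Tendsto (fun n => ∫ x in S n, G n x ^ 2 ∂(densityLaw μ (f n))) atTop (𝓝 0) := by
  have := hf₀.isProbabilityMeasure
  have hS₀ : Tendsto (fun n => (densityLaw μ f₀).real (S n)) atTop (𝓝 0) := by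
    simp only [(hf _).measureReal_densityLaw (hS _), hf₀.measureReal_densityLaw (hS _)] at hSlim ⊢
    refine tendsto_setIntegral_sq_of_sub (.of_forall fun _ => hf₀.memLp_sqrt)
      (.of_forall fun n => (hf n).memLp_sqrt) ?_ hSlim
    simpa only [sub_self, rootDensity] using hff₀.const_sub (rootDensity μ f₀)
  have hG₀S : Tendsto (fun n => ∫ x in S n, G₀ x ^ 2 ∂(densityLaw μ f₀)) atTop (𝓝 0) :=
    ((hf₀.memLp_densityLaw_iff hG₀).2 hG₀').integrable_sq.tendsto_setIntegral_nhds_zero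
      ((ENNReal.tendsto_toReal_zero_iff fun n => measure_ne_top _ _).1 hS₀)
  simp only [(hf _).setIntegral_sq_densityLaw _ (hS _), hf₀.setIntegral_sq_densityLaw _ (hS _)]
    at hG₀S ⊢
  refine tendsto_setIntegral_sq_of_sub hG (.of_forall fun _ => hG₀') ?_ hG₀S
  exact tendsto_sub_nhds_zero_iff.2 hGG₀

lemma tendsto_measureReal_sqrt_mul_lt_abs {Q : ℕ → Measure 𝒳} (hG : ∀ n, Measurable (G n))
    (hG2 : ∀ᶠ n in atTop, MemLp (G n) 2 (Q n)) {c : ℝ}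
    (hlim : Tendsto (fun n => ∫ x, G n x ^ 2 ∂(Q n)) atTop (𝓝 c)) {ε : ℝ} (hε : 0 < ε) :
    Tendsto (fun n : ℕ => (Q n).real {x | √n * ε < |G n x|}) atTop (𝓝 0) := by
  have hn : Tendsto (fun n : ℕ => ((n : ℝ) * ε ^ 2)⁻¹ * ∫ x, G n x ^ 2 ∂(Q n)) atTop (𝓝 0) := by
    simpa using (tendsto_natCast_atTop_atTop.atTop_mul_const
      (pow_pos hε 2)).inv_tendsto_atTop.mul hlim
  refine squeeze_zero' (.of_forall fun n => measureReal_nonneg) ?_ hn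
  filter_upwards [hG2, eventually_gt_atTop 0] with n hGn hn0
  have hpos : 0 < √(n : ℝ) * ε := mul_pos (Real.sqrt_pos.2 (Nat.cast_pos.2 hn0)) hε
  have hmarkov := (mul_measureReal_lt_abs_le (hG n) hGn hpos).trans
    (setIntegral_le_integral hGn.integrable_sq (.of_forall fun x => sq_nonneg _))
  rw [mul_pow, Real.sq_sqrt n.cast_nonneg] at hmarkov
  rwa [inv_mul_eq_div, le_div_iff₀ (by positivity), mul_comm]

lemma isLindebergArray_of_tendsto_toL2 (hf : ∀ n, IsDensity μ (f n)) (hf₀ : IsDensity μ f₀)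
    (hff₀ : Tendsto (fun n => rootDensity μ (f n)) atTop (𝓝 (rootDensity μ f₀)))
    (hG : ∀ n, Measurable (G n)) (hG' : ∀ᶠ n in atTop, MemLp (fun x => G n x * √(f n x)) 2 μ)
    (hG₀ : Measurable G₀) (hG₀' : MemLp (fun x => G₀ x * √(f₀ x)) 2 μ)
    (hGG₀ : Tendsto (fun n => toL2 μ fun x => G n x * √(f n x)) atTop
      (𝓝 (toL2 μ fun x => G₀ x * √(f₀ x)))) :
    IsLindebergArray (fun n => densityLaw μ (f n)) (fun n x => 1 / √(n : ℝ) * G n x)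
      (‖toL2 μ fun x => G₀ x * √(f₀ x)‖ ^ 2) := by
  have hG2 : ∀ᶠ n in atTop, MemLp (G n) 2 (densityLaw μ (f n)) :=
    hG'.mono fun n hn => ((hf n).memLp_densityLaw_iff (hG n)).2 hn
  have hscale (n : ℕ) (hn : 0 < n) (ν : Measure 𝒳) :
      n * ∫ x, (1 / √(n : ℝ) * G n x) ^ 2 ∂ν = ∫ x, G n x ^ 2 ∂ν := by
    simp only [mul_pow, integral_const_mul, div_pow, one_pow, Real.sq_sqrt n.cast_nonneg]
    field_simp
  have hsq : Tendsto (fun n => ∫ x, G n x ^ 2 ∂(densityLaw μ (f n))) atTop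
      (𝓝 (‖toL2 μ fun x => G₀ x * √(f₀ x)‖ ^ 2)) := by
    refine (hGG₀.norm.pow 2).congr' ?_
    filter_upwards [hG'] with n hn
    rw [norm_toL2_sq hn, (hf n).integral_sq_densityLaw]
  refine ⟨fun n => (hG n).const_mul _, hG2.mono fun n hn => hn.const_mul _, hsq.congr' ?_,
    fun ε hε => ?_⟩
  · filter_upwards [eventually_gt_atTop 0] with n hn using (hscale n hn _).symm
  have htail := tendsto_setIntegral_sq_densityLaw hf hf₀ hff₀ hG' hG₀ hG₀' hGG₀
    (fun n => measurableSet_lt_abs (hG n) _) (tendsto_measureReal_sqrt_mul_lt_abs hG hG2 hsq hε)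
  refine htail.congr' ?_
  filter_upwards [eventually_gt_atTop 0] with n hn
  have hset : {x | ε < |1 / √(n : ℝ) * G n x|} = {x | √(n : ℝ) * ε < |G n x|} := by
    ext x
    have hpos : 0 < √(n : ℝ) := Real.sqrt_pos.2 (Nat.cast_pos.2 hn)
    rw [Set.mem_ofPred_eq, Set.mem_ofPred_eq, abs_mul, abs_of_pos (one_div_pos.2 hpos),
      one_div_mul_eq_div, lt_div_iff₀ hpos, mul_comm]
  rw [hset, hscale n hn]

end ScaledArrays

section RandomSamples

variable {𝒳 Ω ι : Type*} [MeasurableSpace 𝒳] [MeasurableSpace Ω] [Fintype ι] {P : Measure Ω}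
  {Q : Measure 𝒳} {X : ι → Ω → 𝒳} {g : 𝒳 → ℝ}

lemma aemeasurable_sum_comp (hX : ∀ i, HasLaw (X i) Q P) (hg : Measurable g) :
    AEMeasurable (fun ω => ∑ i, g (X i ω)) P :=
  Finset.aemeasurable_fun_sum _ fun i _ => hg.comp_aemeasurable (hX i).aemeasurable

lemma memLp_comp {q : ENNReal} {Y : Ω → 𝒳} (hY : HasLaw Y Q P) (hg : MemLp g q Q) :
    MemLp (fun ω => g (Y ω)) q P :=
  MemLp.comp_of_map (hY.map_eq ▸ hg) hY.aemeasurable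

lemma integral_sum_comp (hX : ∀ i, HasLaw (X i) Q P) (hg : Integrable g Q) :
    ∫ ω, ∑ i, g (X i ω) ∂P = Fintype.card ι * ∫ x, g x ∂Q := by
  have hcomp (i : ι) : ∫ ω, g (X i ω) ∂P = ∫ x, g x ∂Q :=
    (hX i).integral_comp hg.aestronglyMeasurable
  rw [integral_finsetSum _ fun i _ =>
    memLp_one_iff_integrable.1 (memLp_comp (hX i) (memLp_one_iff_integrable.2 hg))]
  simp [hcomp]

lemma variance_sum_comp_le [IsProbabilityMeasure P] (hindep : iIndepFun X P)
    (hX : ∀ i, HasLaw (X i) Q P) (hgm : Measurable g) (hg : MemLp g 2 Q) :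
    Var[fun ω => ∑ i, g (X i ω); P] ≤ Fintype.card ι * ∫ x, g x ^ 2 ∂Q := by
  have hmem (i : ι) := memLp_comp (hX i) hg
  have hsq (i : ι) : ∫ ω, g (X i ω) ^ 2 ∂P = ∫ x, g x ^ 2 ∂Q :=
    (hX i).integral_comp (f := fun x => g x ^ 2) (hgm.pow_const 2).aestronglyMeasurable
  have hvar (i : ι) : Var[fun ω => g (X i ω); P] ≤ ∫ x, g x ^ 2 ∂Q :=
    hsq i ▸ variance_le_expectation_sq (hmem i).1
  rw [← Finset.sum_fn, IndepFun.variance_sum (fun i _ => hmem i)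
    fun i _ j _ hij => (hindep.indepFun hij).comp hgm hgm]
  simpa using Finset.sum_le_sum fun i (_ : i ∈ Finset.univ) => hvar i

lemma charFun_map_sum_comp [IsProbabilityMeasure P] (hindep : iIndepFun X P)
    (hX : ∀ i, HasLaw (X i) Q P) (hg : Measurable g) (t : ℝ) :
    charFun (P.map fun ω => ∑ i, g (X i ω)) t = charFun (Q.map g) t ^ Fintype.card ι := by
  have hlaw (i : ι) : P.map (fun ω => g (X i ω)) = Q.map g := by
    rw [← (hX i).map_eq, AEMeasurable.map_map_of_aemeasurable hg.aemeasurable (hX i).aemeasurable]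
    rfl
  have hcomp : iIndepFun (fun i ω => g (X i ω)) P := hindep.comp (fun _ => g) fun _ => hg
  have haem (i : ι) : AEMeasurable (fun ω => g (X i ω)) P :=
    hg.comp_aemeasurable (hX i).aemeasurable
  rw [hcomp.charFun_map_fun_sum_eq_prod haem]
  simp [hlaw]

end RandomSamples

section CharacteristicFunctions

lemma norm_exp_ofReal_mul_I_sub_le (u : ℝ) :
    ‖Complex.exp (u * Complex.I) - 1 - u * Complex.I‖ ≤ 2 * u ^ 2 := by
  obtain hu | hu := le_or_gt |u| 1
  · have hexp := Complex.norm_exp_sub_one_sub_id_le (x := u * Complex.I) (by simpa using hu)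
    simp only [norm_mul, Complex.norm_real, Complex.norm_I, mul_one, Real.norm_eq_abs,
      sq_abs] at hexp
    linarith [sq_nonneg u]
  · have hexp := Real.norm_exp_I_mul_ofReal_sub_one_le (x := u)
    rw [mul_comm, Real.norm_eq_abs] at hexp
    have htri := norm_sub_le (Complex.exp (u * Complex.I) - 1) (u * Complex.I)
    simp only [norm_mul, Complex.norm_real, Complex.norm_I, mul_one, Real.norm_eq_abs] at htri
    rw [← sq_abs u]
    nlinarith

lemma isLittleO_exp_ofReal_mul_I :
    (fun u : ℝ => Complex.exp (u * Complex.I) - 1 - u * Complex.I + (u : ℂ) ^ 2 / 2)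
      =o[𝓝 0] fun u => u ^ 2 := by
  refine IsBigO.trans_isLittleO ?_ (isLittleO_pow_pow (𝕜 := ℝ) (show 2 < 3 by norm_num))
  have hlim : Tendsto (fun u : ℝ => (u : ℂ) * Complex.I) (𝓝 0) (𝓝 0) :=
    Continuous.tendsto' (by fun_prop) 0 0 (by simp)
  have htaylor := (Complex.exp_sub_sum_range_isBigO_pow 3).comp_tendsto hlim
  refine (htaylor.congr_left fun u => ?_).trans
    (IsBigO.of_bound 1 (.of_forall fun u => ?_))
  · simp only [Function.comp_apply, Finset.sum_range_succ, Finset.sum_range_zero, mul_pow,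
      Complex.I_sq, Nat.factorial]
    push_cast
    ring
  · simp

variable {α : Type*} [MeasurableSpace α]

lemma integral_exp_ofReal_mul_I_sub {Q : Measure α} [IsProbabilityMeasure Q] {v : α → ℝ}
    (hvm : Measurable v) (hv : Integrable v Q) (t : ℝ) :
    ∫ x, (Complex.exp ((t * v x : ℝ) * Complex.I) - 1 - (t * v x : ℝ) * Complex.I) ∂Q
      = charFun (Q.map v) t - 1 - t * (∫ x, v x ∂Q : ℝ) * Complex.I := by
  have hlin : Integrable (fun x => ((t * v x : ℝ) : ℂ) * Complex.I) Q :=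
    ((hv.const_mul t).ofReal (𝕜 := ℂ)).mul_const _
  have hexp : Integrable (fun x => Complex.exp ((t * v x : ℝ) * Complex.I)) Q :=
    .of_bound (by fun_prop) 1 (.of_forall fun x => (Complex.norm_exp_ofReal_mul_I _).le)
  have hsub : Integrable (fun x => Complex.exp ((t * v x : ℝ) * Complex.I) - 1) Q :=
    hexp.sub (integrable_const 1)
  rw [integral_sub hsub hlin, integral_sub hexp (integrable_const 1), integral_mul_const,
    integral_complex_ofReal, integral_const_mul, charFun_apply_real,
    integral_map hvm.aemeasurable (by fun_prop)]
  simp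

lemma IsLindebergArray.tendsto_nat_mul_charFun_sub_one {Q : ℕ → Measure α}
    [∀ n, IsProbabilityMeasure (Q n)] {v : ℕ → α → ℝ} {σ2 m : ℝ} (hv : IsLindebergArray Q v σ2)
    (hm : Tendsto (fun n : ℕ => n * ∫ x, v n x ∂(Q n)) atTop (𝓝 m)) (t : ℝ) :
    Tendsto (fun n : ℕ => n * (charFun ((Q n).map (v n)) t - 1)) atTop
      (𝓝 (t * m * Complex.I - σ2 * t ^ 2 / 2)) := by
  set F : ℝ → ℂ := fun w => Complex.exp ((t * w : ℝ) * Complex.I) - 1 - (t * w : ℝ) * Complex.I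
    with hF
  have hbound (w : ℝ) : ‖F w‖ ≤ (2 * t ^ 2) * w ^ 2 := by
    simpa only [mul_pow, mul_assoc] using norm_exp_ofReal_mul_I_sub_le (t * w)
  have hlittle : (fun w => F w - w ^ 2 • (-(t : ℂ) ^ 2 / 2)) =o[𝓝 0] fun w => w ^ 2 := by
    have hlim : Tendsto (fun w => t * w) (𝓝 0) (𝓝 0) :=
      Continuous.tendsto' (by fun_prop) 0 0 (mul_zero t)
    refine ((isLittleO_exp_ofReal_mul_I.comp_tendsto hlim).trans_isBigO
      (IsBigO.of_bound (t ^ 2) (.of_forall fun w => ?_))).congr_left fun w => ?_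
    · simp [mul_pow]
    · simp only [Function.comp_apply, hF, Complex.real_smul]
      push_cast
      ring
  have hFm : Measurable F := by fun_prop
  have hsecond := hv.tendsto_nat_smul_integral_comp hFm.stronglyMeasurable hbound hlittle
  have hfirst := ((Complex.continuous_ofReal.tendsto m).comp hm).const_mul (t * Complex.I)
  convert (hfirst.add hsecond).congr' ?_ using 2
  · rw [Complex.real_smul]
    ring
  filter_upwards [hv.memLp] with n hn
  rw [hF, integral_exp_ofReal_mul_I_sub (hv.measurable n) (hn.integrable one_le_two)]
  simp only [Function.comp_apply, Complex.real_smul, Complex.ofReal_mul, Complex.ofReal_natCast]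
  ring

end CharacteristicFunctions

section TriangularArrays

variable {𝒳 : Type*} [MeasurableSpace 𝒳] {Ω : ℕ → Type*} [∀ n, MeasurableSpace (Ω n)]
  {P : ∀ n, Measure (Ω n)} {X : ∀ n, Fin n → Ω n → 𝒳} {Q : ℕ → Measure 𝒳}

lemma tendsto_measure_exists_mem [∀ n, IsFiniteMeasure (Q n)]
    (hX : ∀ n i, HasLaw (X n i) (Q n) (P n)) {S : ℕ → Set 𝒳} (hS : ∀ n, MeasurableSet (S n))
    (hlim : Tendsto (fun n : ℕ => n * (Q n).real (S n)) atTop (𝓝 0)) :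
    Tendsto (fun n => P n {ω | ∃ i, X n i ω ∈ S n}) atTop (𝓝 0) := by
  have hlim' := ENNReal.tendsto_ofReal hlim
  rw [ENNReal.ofReal_zero] at hlim'
  refine tendsto_of_tendsto_of_tendsto_of_le_of_le tendsto_const_nhds hlim' (fun _ => zero_le)
    fun n => ?_
  have hlaw (i : Fin n) : P n {ω | X n i ω ∈ S n} = Q n (S n) := (hX n i).measure_eq (hS n)
  calc P n {ω | ∃ i, X n i ω ∈ S n}
      ≤ ∑ i, P n {ω | X n i ω ∈ S n} := by
        rw [Set.ofPred_exists]
        exact measure_iUnion_fintype_le _ _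
    _ = ENNReal.ofReal (n * (Q n).real (S n)) := by
        simp [hlaw, ENNReal.ofReal_mul]

lemma isLittleOInProb_sum_sub [∀ n, IsProbabilityMeasure (P n)]
    [∀ n, IsProbabilityMeasure (Q n)]
    (hindep : ∀ n, iIndepFun (X n) (P n)) (hX : ∀ n i, HasLaw (X n i) (Q n) (P n))
    {Z : ℕ → 𝒳 → ℝ} {m : ℝ} (hZ : ∀ n, Measurable (Z n))
    (hZ2 : ∀ᶠ n in atTop, MemLp (Z n) 2 (Q n))
    (hm : Tendsto (fun n : ℕ => n * ∫ x, Z n x ∂(Q n)) atTop (𝓝 m))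
    (hsq : Tendsto (fun n : ℕ => n * ∫ x, Z n x ^ 2 ∂(Q n)) atTop (𝓝 0)) :
    IsLittleOInProb P fun n ω => ∑ i, Z n (X n i ω) - m := by
  intro ε hε
  have hlim : Tendsto (fun n : ℕ => ENNReal.ofReal ((n * ∫ x, Z n x ^ 2 ∂(Q n)) / (ε / 2) ^ 2))
      atTop (𝓝 0) := by
    simpa using ENNReal.tendsto_ofReal (hsq.div_const ((ε / 2) ^ 2))
  refine tendsto_of_tendsto_of_tendsto_of_le_of_le' tendsto_const_nhds hlim
    (.of_forall fun _ => zero_le) ?_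
  filter_upwards [hZ2, Metric.tendsto_nhds.1 hm (ε / 2) (half_pos hε)] with n hn hmean
  have hsum : MemLp (fun ω => ∑ i, Z n (X n i ω)) 2 (P n) :=
    memLp_finsetSum _ fun i _ => memLp_comp (hX n i) hn
  have hvar := variance_sum_comp_le (hindep n) (hX n) (hZ n) hn
  have hexp := integral_sum_comp (hX n) (hn.integrable one_le_two)
  rw [Fintype.card_fin] at hvar hexp
  calc P n {ω | ε ≤ |∑ i, Z n (X n i ω) - m|}
      ≤ P n {ω | ε / 2 ≤ |∑ i, Z n (X n i ω) - ∫ ω, ∑ i, Z n (X n i ω) ∂(P n)|} := by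
        refine measure_mono fun ω (hω : ε ≤ _) => ?_
        rw [Set.mem_ofPred_eq, hexp]
        rw [Real.dist_eq] at hmean
        linarith [abs_sub_le (∑ i, Z n (X n i ω)) (n * ∫ x, Z n x ∂(Q n)) m]
    _ ≤ _ := meas_ge_le_variance_div_sq hsum (half_pos hε)
    _ ≤ _ := ENNReal.ofReal_le_ofReal (div_le_div_of_nonneg_right hvar (sq_nonneg _))

/- The `n`-th row sum has characteristic function `(1 + zₙ / n) ^ n`, where `zₙ` converges to the
exponent of the Gaussian characteristic function. -/
lemma IsLindebergArray.tendstoInDistribution_sum [∀ n, IsProbabilityMeasure (P n)]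
    [∀ n, IsProbabilityMeasure (Q n)] {v : ℕ → 𝒳 → ℝ} {σ2 m : ℝ} (hv : IsLindebergArray Q v σ2)
    (hm : Tendsto (fun n : ℕ => n * ∫ x, v n x ∂(Q n)) atTop (𝓝 m))
    (hindep : ∀ n, iIndepFun (X n) (P n)) (hX : ∀ n i, HasLaw (X n i) (Q n) (P n)) :
    TendstoInDistribution (fun n ω => ∑ i, v n (X n i ω)) atTop id P
      (gaussianReal m σ2.toNNReal) where
  forall_aemeasurable n := aemeasurable_sum_comp (hX n) (hv.measurable n)
  tendsto := by
    have hσ2 : 0 ≤ σ2 := ge_of_tendsto' hv.tendsto_sq fun n =>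
      mul_nonneg n.cast_nonneg (integral_nonneg fun x => sq_nonneg _)
    refine ProbabilityMeasure.tendsto_iff_tendsto_charFun.2 fun t => ?_
    simp only [ProbabilityMeasure.coe_mk, Measure.map_id, charFun_gaussianReal,
      Real.coe_toNNReal _ hσ2]
    refine (Complex.tendsto_one_add_pow_exp_of_tendsto
      (hv.tendsto_nat_mul_charFun_sub_one hm t)).congr fun n => ?_
    rw [add_sub_cancel, charFun_map_sum_comp (hindep n) (hX n) (hv.measurable n),
      Fintype.card_fin]

end TriangularArrays

section Negligible

variable {Ω : ℕ → Type*} [∀ n, MeasurableSpace (Ω n)] {P : ∀ n, Measure (Ω n)}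
  {D : ∀ n, Set (Ω n)} {R R' : ∀ n, Ω n → ℝ}

lemma IsLittleOInProb.congr_of_tendsto (hR : IsLittleOInProb P R)
    (hD : Tendsto (fun n => P n (D n)) atTop (𝓝 0))
    (hRR' : ∀ n, ∀ ω ∉ D n, R' n ω = R n ω) : IsLittleOInProb P R' := by
  intro ε hε
  have hlim := (hR ε hε).add hD
  rw [zero_add] at hlim
  refine tendsto_of_tendsto_of_tendsto_of_le_of_le tendsto_const_nhds hlim (fun _ => zero_le)
    fun n => (measure_mono fun ω (hω : ε ≤ |R' n ω|) => ?_).trans (measure_union_le _ _)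
  by_cases hωD : ω ∈ D n
  · exact Or.inr hωD
  · exact Or.inl (hω.trans_eq (congrArg _ (hRR' n ω hωD)))

lemma tendsto_measure_of_compl_subset [∀ n, IsProbabilityMeasure (P n)]
    (hD : Tendsto (fun n => P n (D n)) atTop (𝓝 0)) {S : ∀ n, Set (Ω n)}
    (hS : ∀ n, (D n)ᶜ ⊆ S n) : Tendsto (fun n => P n (S n)) atTop (𝓝 1) := by
  have hlim : Tendsto (fun n => 1 - P n (D n)) atTop (𝓝 1) := by
    simpa using ENNReal.Tendsto.sub tendsto_const_nhds hD (Or.inl ENNReal.one_ne_top)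
  refine tendsto_of_tendsto_of_tendsto_of_le_of_le hlim tendsto_const_nhds (fun n => ?_)
    fun n => prob_le_one
  rw [tsub_le_iff_right, ← measure_univ (μ := P n), ← Set.compl_union_self (D n)]
  exact (measure_union_le _ _).trans (add_le_add (measure_mono (hS n)) le_rfl)

lemma norm_charFun_map_sub_le {Ω' : Type*} [MeasurableSpace Ω'] {P' : Measure Ω'}
    [IsProbabilityMeasure P'] {Y Z : Ω' → ℝ} (hY : AEMeasurable Y P') (hZ : AEMeasurable Z P')
    (t : ℝ) : ‖charFun (P'.map Y) t - charFun (P'.map Z) t‖ ≤ 2 * P'.real {ω | Y ω ≠ Z ω} := by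
  have hnorm (y : ℝ) : ‖Complex.exp (t * y * Complex.I)‖ = 1 := by
    rw [← Complex.ofReal_mul, Complex.norm_exp_ofReal_mul_I]
  have hint {V : Ω' → ℝ} (hV : AEMeasurable V P') :
      Integrable (fun ω => Complex.exp (t * V ω * Complex.I)) P' :=
    .of_bound (by fun_prop) 1 (.of_forall fun ω => (hnorm _).le)
  have hne : NullMeasurableSet {ω | Y ω ≠ Z ω} P' := (nullMeasurableSet_eq_fun hY hZ).compl
  rw [charFun_apply_real, charFun_apply_real, integral_map hY (by fun_prop),
    integral_map hZ (by fun_prop), ← integral_sub (hint hY) (hint hZ)]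
  calc ‖∫ ω, (Complex.exp (t * Y ω * Complex.I) - Complex.exp (t * Z ω * Complex.I)) ∂P'‖
      ≤ ∫ ω, {ω | Y ω ≠ Z ω}.indicator (fun _ => (2 : ℝ)) ω ∂P' := by
        refine norm_integral_le_of_norm_le ((integrable_const 2).indicator₀ hne)
          (.of_forall fun ω => ?_)
        simp only [Set.indicator_apply, Set.mem_ofPred_eq]
        split_ifs with hω
        · exact (norm_sub_le _ _).trans (by rw [hnorm, hnorm]; norm_num)
        · rw [not_not.1 hω, sub_self, norm_zero]
    _ = 2 * P'.real {ω | Y ω ≠ Z ω} := by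
        rw [integral_indicator₀ hne, setIntegral_const, smul_eq_mul, mul_comm]

lemma tendstoInDistribution_congr_of_tendsto [∀ n, IsProbabilityMeasure (P n)] {Ω' : Type*}
    [MeasurableSpace Ω'] {P' : Measure Ω'} [IsProbabilityMeasure P'] {Z : Ω' → ℝ}
    (hR : TendstoInDistribution R atTop Z P P') (hR' : ∀ n, AEMeasurable (R' n) (P n))
    (hD : Tendsto (fun n => P n (D n)) atTop (𝓝 0))
    (hRR' : ∀ n, ∀ ω ∉ D n, R' n ω = R n ω) : TendstoInDistribution R' atTop Z P P' where
  forall_aemeasurable := hR'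
  aemeasurable_limit := hR.aemeasurable_limit
  tendsto := by
    refine ProbabilityMeasure.tendsto_iff_tendsto_charFun.2 fun t => ?_
    have hbound := ((ENNReal.tendsto_toReal ENNReal.zero_ne_top).comp hD).const_mul 2
    rw [ENNReal.toReal_zero, mul_zero] at hbound
    have hdiff : Tendsto (fun n => charFun ((P n).map (R' n)) t - charFun ((P n).map (R n)) t)
        atTop (𝓝 0) := by
      refine squeeze_zero_norm (fun n => (norm_charFun_map_sub_le (hR' n)
        (hR.forall_aemeasurable n) t).trans ?_) hbound
      exact mul_le_mul_of_nonneg_left (measureReal_mono fun ω hω => by_contra fun hωD =>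
        hω (hRR' n ω hωD)) zero_le_two
    simpa using hdiff.add (ProbabilityMeasure.tendsto_iff_tendsto_charFun.1 hR.tendsto t)

end Negligible

section LogExpansion

/-- The logarithm `2 log (1 + w / 2)` of the squared ratio of root densities with relative
increment `w`, truncated to `0` when `|w| > 1`. -/
noncomputable def truncLog (w : ℝ) : ℝ := if |w| ≤ 1 then 2 * Real.log (1 + w / 2) else 0

lemma measurable_truncLog : Measurable truncLog := by
  refine Measurable.ite (measurableSet_le measurable_id.abs measurable_const) ?_ measurable_const
  exact ((measurable_id.div_const 2).const_add 1).log.const_mul 2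

lemma abs_sum_add_log_one_add_half_le {w : ℝ} (hw : |w| ≤ 1) (m : ℕ) :
    |(∑ i ∈ Finset.range m, (-(w / 2)) ^ (i + 1) / (i + 1)) + Real.log (1 + w / 2)|
      ≤ 2 * (|w| / 2) ^ (m + 1) := by
  have habs : |-(w / 2)| = |w| / 2 := by rw [abs_neg, abs_div, abs_two]
  have htaylor := Real.abs_log_sub_add_sum_range_le (x := -(w / 2)) (by linarith) m
  rw [sub_neg_eq_add, habs] at htaylor
  refine htaylor.trans ?_
  rw [div_le_iff₀ (by linarith)]
  have hpow : 0 ≤ (|w| / 2) ^ (m + 1) := by positivity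
  nlinarith

lemma abs_truncLog_sub_le_sq (w : ℝ) : |truncLog w - w| ≤ w ^ 2 := by
  rw [← sq_abs]
  by_cases hw : |w| ≤ 1
  · have htaylor := abs_sum_add_log_one_add_half_le hw 1
    have hsum : truncLog w - w = 2 * ((∑ i ∈ Finset.range 1, (-(w / 2)) ^ (i + 1) / ((i : ℝ) + 1))
        + Real.log (1 + w / 2)) := by
      rw [truncLog, if_pos hw, Finset.sum_range_one]
      push_cast
      ring
    rw [hsum, abs_mul, abs_two]
    linarith
  · simp only [truncLog, hw, if_false, zero_sub, abs_neg]
    nlinarith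

lemma abs_truncLog_sub_le (w : ℝ) : |truncLog w - w| ≤ |w| := by
  by_cases hw : |w| ≤ 1
  · refine (abs_truncLog_sub_le_sq w).trans ?_
    rw [← sq_abs]
    exact pow_le_of_le_one (abs_nonneg w) hw two_ne_zero
  · simp [truncLog, hw]

lemma isLittleO_truncLog_sub :
    (fun w : ℝ => truncLog w - w - w ^ 2 • (-(1 / 4) : ℝ)) =o[𝓝 0] fun w => w ^ 2 := by
  refine (IsBigO.of_bound 1 ?_).trans_isLittleO (isLittleO_pow_pow (show 2 < 3 by norm_num))
  filter_upwards [(continuous_abs.tendsto' (0 : ℝ) 0 abs_zero).eventually_le_const one_pos]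
    with w hw
  have htaylor := abs_sum_add_log_one_add_half_le hw 2
  have hsum : truncLog w - w - w ^ 2 • (-(1 / 4) : ℝ)
      = 2 * ((∑ i ∈ Finset.range 2, (-(w / 2)) ^ (i + 1) / ((i : ℝ) + 1))
        + Real.log (1 + w / 2)) := by
    rw [truncLog, if_pos hw, smul_eq_mul, Finset.sum_range_succ, Finset.sum_range_one]
    push_cast
    ring
  have hpow : 0 ≤ |w| ^ 3 := by positivity
  rw [hsum, norm_mul, Real.norm_eq_abs, Real.norm_eq_abs, Real.norm_eq_abs, abs_two, abs_pow]
  linarith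

variable {α : Type*} [MeasurableSpace α] {Q : ℕ → Measure α} {v w : ℕ → α → ℝ} {σ2 m : ℝ}

namespace IsLindebergArray

lemma tendsto_nat_mul_integral_truncLog_sub (hw : IsLindebergArray Q w σ2) :
    Tendsto (fun n : ℕ => n * ∫ x, (truncLog (w n x) - w n x) ∂(Q n)) atTop
      (𝓝 (-(1 / 4) * σ2)) := by
  have hlim := hw.tendsto_nat_smul_integral_comp (F := fun w => truncLog w - w)
    (measurable_truncLog.sub measurable_id).stronglyMeasurable
    (fun w => (one_mul (w ^ 2)).symm ▸ abs_truncLog_sub_le_sq w) isLittleO_truncLog_sub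
  simpa only [smul_eq_mul, mul_comm σ2] using hlim

lemma tendsto_nat_mul_integral_truncLog_sub_sq (hw : IsLindebergArray Q w σ2) :
    Tendsto (fun n : ℕ => n * ∫ x, (truncLog (w n x) - w n x) ^ 2 ∂(Q n)) atTop (𝓝 0) := by
  refine hw.tendsto_nat_smul_integral_of_isLittleO (F := fun w => (truncLog w - w) ^ 2) (C := 1)
    (fun w => ?_) ?_
  · rw [one_mul, norm_pow, Real.norm_eq_abs, ← sq_abs w]
    exact pow_le_pow_left₀ (abs_nonneg _) (abs_truncLog_sub_le w) 2
  · refine (IsBigO.of_bound 1 (.of_forall fun w => ?_)).trans_isLittleO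
      (isLittleO_pow_pow (show 2 < 4 by norm_num))
    rw [one_mul, norm_pow, Real.norm_eq_abs, Real.norm_of_nonneg (by positivity)]
    exact (pow_le_pow_left₀ (abs_nonneg _) (abs_truncLog_sub_le_sq w) 2).trans_eq (by ring)

lemma truncLog_comp (hw : IsLindebergArray Q w σ2) :
    IsLindebergArray Q (fun n x => truncLog (w n x)) σ2 := by
  have hmeas (n : ℕ) : Measurable fun x => truncLog (w n x) :=
    measurable_truncLog.comp (hw.measurable n)
  refine hw.of_sub hmeas (hw.memLp.mono fun n hn => ?_) hw.tendsto_nat_mul_integral_truncLog_sub_sq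
  have hsub : MemLp (fun x => truncLog (w n x) - w n x) 2 (Q n) :=
    hn.mono ((hmeas n).sub (hw.measurable n)).aestronglyMeasurable
      (.of_forall fun x => abs_truncLog_sub_le _)
  simpa [Pi.add_def] using hsub.add hn

lemma tendsto_nat_mul_integral_truncLog [∀ n, IsFiniteMeasure (Q n)]
    (hw : IsLindebergArray Q w σ2)
    (hm : Tendsto (fun n : ℕ => n * ∫ x, w n x ∂(Q n)) atTop (𝓝 m)) :
    Tendsto (fun n : ℕ => n * ∫ x, truncLog (w n x) ∂(Q n)) atTop (𝓝 (m - 1 / 4 * σ2)) := by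
  have hlim := hm.add hw.tendsto_nat_mul_integral_truncLog_sub
  rw [neg_mul, ← sub_eq_add_neg] at hlim
  refine hlim.congr' ?_
  filter_upwards [hw.memLp, hw.truncLog_comp.memLp] with n hn hTn
  rw [integral_sub (hTn.integrable one_le_two) (hn.integrable one_le_two)]
  ring

lemma tendsto_nat_mul_integral_truncLog_sub_sq_of_sub (hw : IsLindebergArray Q w σ2)
    (hv : ∀ᶠ n in atTop, MemLp (v n) 2 (Q n))
    (hwv : Tendsto (fun n : ℕ => n * ∫ x, (w n x - v n x) ^ 2 ∂(Q n)) atTop (𝓝 0)) :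
    Tendsto (fun n : ℕ => n * ∫ x, (truncLog (w n x) - v n x) ^ 2 ∂(Q n)) atTop (𝓝 0) := by
  have hlim := (hw.tendsto_nat_mul_integral_truncLog_sub_sq.const_mul 2).add (hwv.const_mul 2)
  rw [mul_zero, add_zero] at hlim
  refine squeeze_zero' (.of_forall fun n => mul_nonneg n.cast_nonneg
    (integral_nonneg fun x => sq_nonneg _)) ?_ hlim
  filter_upwards [hw.memLp, hw.truncLog_comp.memLp, hv] with n hwn hTn hvn
  have hTw : Integrable (fun x => 2 * (truncLog (w n x) - w n x) ^ 2) (Q n) :=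
    (hTn.sub hwn).integrable_sq.const_mul 2
  have hwv : Integrable (fun x => 2 * (w n x - v n x) ^ 2) (Q n) :=
    (hwn.sub hvn).integrable_sq.const_mul 2
  have hmono := integral_mono (hTn.sub hvn).integrable_sq (hTw.add hwv) fun x => by
    simp only [Pi.sub_apply, Pi.add_apply]
    nlinarith [sq_nonneg ((truncLog (w n x) - w n x) - (w n x - v n x))]
  calc n * ∫ x, (truncLog (w n x) - v n x) ^ 2 ∂(Q n)
      ≤ n * ∫ x, (2 * (truncLog (w n x) - w n x) ^ 2 + 2 * (w n x - v n x) ^ 2) ∂(Q n) :=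
        mul_le_mul_of_nonneg_left hmono n.cast_nonneg
    _ = _ := by
        rw [integral_add hTw hwv, integral_const_mul, integral_const_mul]
        ring

end IsLindebergArray

end LogExpansion

section LikelihoodRatios

lemma sum_log_sub_sum_log {𝒳 ι : Type*} [Fintype ι] {f₀ f₁ : 𝒳 → ℝ} {x : ι → 𝒳}
    (hx : ∀ i, |rootIncrement f₀ f₁ (x i)| ≤ 1) :
    ∑ i, Real.log (f₁ (x i)) - ∑ i, Real.log (f₀ (x i))
      = ∑ i, truncLog (rootIncrement f₀ f₁ (x i)) := by
  rw [← Finset.sum_sub_distrib]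
  refine Finset.sum_congr rfl fun i _ => ?_
  obtain ⟨h₀, h₁⟩ := pos_of_abs_rootIncrement_le_one (hx i)
  rw [truncLog, if_pos (hx i), two_mul_log_one_add_rootIncrement h₀ h₁]

variable {𝒳 : Type*} [MeasurableSpace 𝒳] {μ : Measure 𝒳} {f₀ f₁ v G : ℕ → 𝒳 → ℝ} {σ2 : ℝ}
  {D : Lp ℝ 2 μ}

lemma tendsto_nat_mul_integral_rootIncrement (h₀ : ∀ n, IsDensity μ (f₀ n))
    (h₁ : ∀ n, IsDensity μ (f₁ n))
    (hΔ : Tendsto (fun n : ℕ => √(n : ℝ) • (rootDensity μ (f₁ n) - rootDensity μ (f₀ n))) atTop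
      (𝓝 D)) :
    Tendsto (fun n : ℕ => n * ∫ x, rootIncrement (f₀ n) (f₁ n) x ∂(densityLaw μ (f₀ n))) atTop
      (𝓝 (-‖D‖ ^ 2)) := by
  refine (hΔ.norm.pow 2).neg.congr fun n => ?_
  rw [integral_rootIncrement (h₀ n) (h₁ n), norm_smul, mul_pow,
    Real.norm_of_nonneg (Real.sqrt_nonneg _), Real.sq_sqrt n.cast_nonneg, mul_neg]

lemma tendsto_nat_mul_integral_rootIncrement_sub_sq (h₀ : ∀ n, IsDensity μ (f₀ n))
    (h₁ : ∀ n, IsDensity μ (f₁ n))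
    (hΔ : Tendsto (fun n : ℕ => √(n : ℝ) • (rootDensity μ (f₁ n) - rootDensity μ (f₀ n))) atTop
      (𝓝 D))
    (hG : ∀ᶠ n in atTop, MemLp (fun x => G n x * √(f₀ n x)) 2 μ)
    (hGD : Tendsto (fun n => toL2 μ fun x => G n x * √(f₀ n x)) atTop (𝓝 ((2 : ℝ) • D))) :
    Tendsto (fun n : ℕ => (n : ℝ) * ∫ x, (rootIncrement (f₀ n) (f₁ n) x - 1 / √(n : ℝ) * G n x) ^ 2
      ∂(densityLaw μ (f₀ n))) atTop (𝓝 0) := by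
  have hlim := (((hΔ.const_smul (2 : ℝ)).sub hGD).norm.pow 2)
  rw [sub_self, norm_zero, zero_pow two_ne_zero] at hlim
  refine squeeze_zero' (.of_forall fun n => mul_nonneg n.cast_nonneg
    (integral_nonneg fun x => sq_nonneg _)) ?_ hlim
  filter_upwards [hG, eventually_gt_atTop 0] with n hGn hn
  have hsqrt : √(n : ℝ) ≠ 0 := Real.sqrt_ne_zero'.2 (Nat.cast_pos.2 hn)
  refine le_of_eq_of_le ?_
    ((integral_smul_rootIncrement_sub_sq_le (h₀ n) (h₁ n) hGn (√(n : ℝ))).trans_eq ?_)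
  · rw [← integral_const_mul]
    refine integral_congr_ae (.of_forall fun x => ?_)
    calc n * (rootIncrement (f₀ n) (f₁ n) x - 1 / √(n : ℝ) * G n x) ^ 2
        = (√(n : ℝ) * (rootIncrement (f₀ n) (f₁ n) x - 1 / √(n : ℝ) * G n x)) ^ 2 := by
          rw [mul_pow, Real.sq_sqrt n.cast_nonneg]
      _ = (√(n : ℝ) * rootIncrement (f₀ n) (f₁ n) x - G n x) ^ 2 := by
          field_simp
  · rw [mul_smul]

variable {Ω : ℕ → Type*} [∀ n, MeasurableSpace (Ω n)] {P : ∀ n, Measure (Ω n)}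
  {X : ∀ n, Fin n → Ω n → 𝒳}

lemma tendsto_measure_exists_one_lt_abs_rootIncrement (h₀ : ∀ n, IsDensity μ (f₀ n))
    (hw : IsLindebergArray (fun n => densityLaw μ (f₀ n)) (fun n => rootIncrement (f₀ n) (f₁ n)) σ2)
    (hX : ∀ n i, HasLaw (X n i) (densityLaw μ (f₀ n)) (P n)) :
    Tendsto (fun n => P n {ω | ∃ i, 1 < |rootIncrement (f₀ n) (f₁ n) (X n i ω)|}) atTop (𝓝 0) :=
  have (n : ℕ) := (h₀ n).isProbabilityMeasure
  tendsto_measure_exists_mem hX (fun n => measurableSet_lt_abs (hw.measurable n) 1)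
    (hw.tendsto_nat_mul_measureReal one_pos)

variable [∀ n, IsProbabilityMeasure (P n)]

lemma tendsto_measure_forall_pos (h₀ : ∀ n, IsDensity μ (f₀ n))
    (hw : IsLindebergArray (fun n => densityLaw μ (f₀ n)) (fun n => rootIncrement (f₀ n) (f₁ n)) σ2)
    (hX : ∀ n i, HasLaw (X n i) (densityLaw μ (f₀ n)) (P n)) :
    Tendsto (fun n => P n {ω | ∀ i, 0 < f₁ n (X n i ω) ∧ 0 < f₀ n (X n i ω)}) atTop (𝓝 1) := by
  refine tendsto_measure_of_compl_subset
    (tendsto_measure_exists_one_lt_abs_rootIncrement h₀ hw hX) fun n ω hω i => ?_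
  exact (pos_of_abs_rootIncrement_le_one (not_lt.1 (not_exists.1 hω i))).symm

lemma isLittleOInProb_sum_log_sub (h₀ : ∀ n, IsDensity μ (f₀ n))
    (hv : IsLindebergArray (fun n => densityLaw μ (f₀ n)) v σ2)
    (hv₀ : ∀ᶠ n in atTop, ∫ x, v n x ∂(densityLaw μ (f₀ n)) = 0)
    (hw : IsLindebergArray (fun n => densityLaw μ (f₀ n)) (fun n => rootIncrement (f₀ n) (f₁ n)) σ2)
    (hw₁ : Tendsto (fun n : ℕ => n * ∫ x, rootIncrement (f₀ n) (f₁ n) x ∂(densityLaw μ (f₀ n)))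
      atTop (𝓝 (-(1 / 4) * σ2)))
    (hwv : Tendsto (fun n : ℕ => n * ∫ x, (rootIncrement (f₀ n) (f₁ n) x - v n x) ^ 2
      ∂(densityLaw μ (f₀ n))) atTop (𝓝 0))
    (hindep : ∀ n, iIndepFun (X n) (P n))
    (hX : ∀ n i, HasLaw (X n i) (densityLaw μ (f₀ n)) (P n)) :
    IsLittleOInProb P fun n ω => ∑ i, Real.log (f₁ n (X n i ω)) - ∑ i, Real.log (f₀ n (X n i ω))
      - (∑ i, v n (X n i ω) - 1 / 2 * σ2) := by
  have (n : ℕ) := (h₀ n).isProbabilityMeasure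
  have hT := hw.truncLog_comp
  have hmean : Tendsto (fun n : ℕ => n * ∫ x, (truncLog (rootIncrement (f₀ n) (f₁ n) x) - v n x)
      ∂(densityLaw μ (f₀ n))) atTop (𝓝 (-(1 / 4) * σ2 - 1 / 4 * σ2)) := by
    refine (hw.tendsto_nat_mul_integral_truncLog hw₁).congr' ?_
    filter_upwards [hT.memLp, hv.memLp, hv₀] with n hTn hvn hvn₀
    rw [integral_sub (hTn.integrable one_le_two) (hvn.integrable one_le_two), hvn₀, sub_zero]
  have hsum := isLittleOInProb_sum_sub hindep hX
    (fun n => (hT.measurable n).sub (hv.measurable n))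
    ((hT.memLp.and hv.memLp).mono fun n hn => hn.1.sub hn.2) hmean
    (hw.tendsto_nat_mul_integral_truncLog_sub_sq_of_sub hv.memLp hwv)
  refine hsum.congr_of_tendsto
    (tendsto_measure_exists_one_lt_abs_rootIncrement h₀ hw hX) fun n ω hω => ?_
  rw [sum_log_sub_sum_log fun i => not_lt.1 (not_exists.1 hω i)]
  simp only [Pi.sub_apply, Finset.sum_sub_distrib]
  ring

lemma tendstoInDistribution_sum_log_sub (h₀ : ∀ n, IsDensity μ (f₀ n))
    (h₁ : ∀ n, Measurable (f₁ n))
    (hw : IsLindebergArray (fun n => densityLaw μ (f₀ n)) (fun n => rootIncrement (f₀ n) (f₁ n)) σ2)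
    (hw₁ : Tendsto (fun n : ℕ => n * ∫ x, rootIncrement (f₀ n) (f₁ n) x ∂(densityLaw μ (f₀ n)))
      atTop (𝓝 (-(1 / 4) * σ2)))
    (hindep : ∀ n, iIndepFun (X n) (P n))
    (hX : ∀ n i, HasLaw (X n i) (densityLaw μ (f₀ n)) (P n)) :
    TendstoInDistribution
      (fun n ω => ∑ i, Real.log (f₁ n (X n i ω)) - ∑ i, Real.log (f₀ n (X n i ω))) atTop id P
      (gaussianReal (-(1 / 2) * σ2) σ2.toNNReal) := by
  have (n : ℕ) := (h₀ n).isProbabilityMeasure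
  have hmean := hw.tendsto_nat_mul_integral_truncLog hw₁
  rw [show -(1 / 4) * σ2 - 1 / 4 * σ2 = -(1 / 2) * σ2 by ring] at hmean
  exact tendstoInDistribution_congr_of_tendsto
    (hw.truncLog_comp.tendstoInDistribution_sum hmean hindep hX)
    (fun n => (aemeasurable_sum_comp (g := fun x => Real.log (f₁ n x)) (hX n) (h₁ n).log).sub
      (aemeasurable_sum_comp (g := fun x => Real.log (f₀ n x)) (hX n) (h₀ n).measurable.log))
    (tendsto_measure_exists_one_lt_abs_rootIncrement h₀ hw hX)
    fun n ω hω => sum_log_sub_sum_log fun i => not_lt.1 (not_exists.1 hω i)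

end LikelihoodRatios

section LocalParameters

variable {𝒳 : Type*} [MeasurableSpace 𝒳] {d : ℕ} {μ : Measure 𝒳}
  {p : EuclideanSpace ℝ (Fin d) → 𝒳 → ℝ}
  {score : EuclideanSpace ℝ (Fin d) → 𝒳 → EuclideanSpace ℝ (Fin d)}
  {θ k : EuclideanSpace ℝ (Fin d)} {a b : ℕ → EuclideanSpace ℝ (Fin d)}
  (hDD : IsDDQM μ p score θ) (hD : ∀ᶠ θ' in 𝓝 θ, HasDQMScore μ p (score θ') θ')
  (hp : ∀ᶠ θ' in 𝓝 θ, IsDensity μ (p θ')) (hs : ∀ᶠ θ' in 𝓝 θ, Measurable (score θ'))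
  (ha : Tendsto a atTop (𝓝 θ)) (hb : Tendsto b atTop (𝓝 θ))
  (hpa : ∀ n, IsDensity μ (p (a n))) (hpb : ∀ n, IsDensity μ (p (b n)))
  (hsb : ∀ n, Measurable (score (b n)))
  (hk : Tendsto (fun n : ℕ => √(n : ℝ) • (a n - b n)) atTop (𝓝 k))

include hD hp hs hb

lemma eventually_memLp_inner_score :
    ∀ᶠ n in atTop, ∀ k, MemLp (fun x => inner ℝ k (score (b n) x) * √(p (b n) x)) 2 μ := by
  filter_upwards [hb.eventually hD, hb.eventually hp.eventually_nhds, hb.eventually hs]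
    with n hDn hpn hsn using hDn.memLp_inner hpn hsn

lemma eventually_integral_inner_score_eq_zero (k : EuclideanSpace ℝ (Fin d)) :
    ∀ᶠ n in atTop, ∫ x, inner ℝ k (score (b n) x) ∂(densityLaw μ (p (b n))) = 0 := by
  filter_upwards [hb.eventually hD, hb.eventually hp.eventually_nhds, hb.eventually hs]
    with n hDn hpn hsn using hDn.integral_inner_score hpn hsn k

include hDD

namespace IsDDQM

lemma tendsto_toL2_inner_score (k : EuclideanSpace ℝ (Fin d)) :
    Tendsto (fun n => toL2 μ fun x => inner ℝ k (score (b n) x) * √(p (b n) x)) atTop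
      (𝓝 (toL2 μ fun x => inner ℝ k (score θ x) * √(p θ x))) := by
  have hderiv := hD.self_of_nhds.hasFDerivAt hp hs.self_of_nhds
  have hlim := (tendsto_apply_of_hasFDerivAt hderiv hb
    (fun _ ha => hDD.isLittleO_rootDensity hD hp hs ha hb)
    (tendsto_const_nhds (x := k))).const_smul (2 : ℝ)
  rw [two_smul_rootScore (hD.self_of_nhds.memLp_inner hp hs.self_of_nhds)] at hlim
  refine hlim.congr' ?_
  filter_upwards [eventually_memLp_inner_score hD hp hs hb] with n hn using two_smul_rootScore hn k

include hpb hsb in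
lemma isLindebergArray_score (k : EuclideanSpace ℝ (Fin d)) :
    IsLindebergArray (fun n => densityLaw μ (p (b n)))
      (fun n x => 1 / √(n : ℝ) * inner ℝ k (score (b n) x))
      (quadForm (fisherInfo μ p score θ) k) := by
  have hpθ := hp.self_of_nhds
  have hsθ := hs.self_of_nhds
  have hmem := hD.self_of_nhds.memLp_inner hp hsθ
  have hroot := (hD.self_of_nhds.hasFDerivAt hp hsθ).continuousAt.tendsto.comp hb
  have hscore := eventually_memLp_inner_score hD hp hs hb
  rw [quadForm_fisherInfo hpθ hsθ hmem]
  exact isLindebergArray_of_tendsto_toL2 hpb hpθ hroot (fun n => measurable_const.inner (hsb n))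
    (hscore.mono fun n hn => hn k) (measurable_const.inner hsθ) (hmem k)
    (hDD.tendsto_toL2_inner_score hD hp hs hb k)

include ha hk

lemma tendsto_sqrt_smul_rootDensity_sub :
    Tendsto (fun n : ℕ => √(n : ℝ) • (rootDensity μ (p (a n)) - rootDensity μ (p (b n)))) atTop
      (𝓝 (rootScore μ (p θ) (score θ) k)) :=
  tendsto_smul_sub_of_hasFDerivAt (hD.self_of_nhds.hasFDerivAt hp hs.self_of_nhds) ha hb
    (fun _ ha => hDD.isLittleO_rootDensity hD hp hs ha hb) hk

include hpa hpb

lemma tendsto_nat_mul_integral_rootIncrement :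
    Tendsto (fun n : ℕ =>
        n * ∫ x, rootIncrement (p (b n)) (p (a n)) x ∂(densityLaw μ (p (b n)))) atTop
      (𝓝 (-(1 / 4) * quadForm (fisherInfo μ p score θ) k)) := by
  have hmem := hD.self_of_nhds.memLp_inner hp hs.self_of_nhds
  have hlim := LocalAsymptotics.tendsto_nat_mul_integral_rootIncrement hpb hpa
    (hDD.tendsto_sqrt_smul_rootDensity_sub hD hp hs ha hb hk)
  convert hlim using 2
  rw [quadForm_fisherInfo hp.self_of_nhds hs.self_of_nhds hmem, ← two_smul_rootScore hmem,
    norm_smul, Real.norm_two]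
  ring

lemma tendsto_nat_mul_integral_rootIncrement_sub_sq :
    Tendsto (fun n : ℕ => (n : ℝ) * ∫ x, (rootIncrement (p (b n)) (p (a n)) x
        - 1 / √(n : ℝ) * inner ℝ k (score (b n) x)) ^ 2 ∂(densityLaw μ (p (b n)))) atTop
      (𝓝 0) := by
  have hscore := hDD.tendsto_toL2_inner_score hD hp hs hb k
  rw [← two_smul_rootScore (hD.self_of_nhds.memLp_inner hp hs.self_of_nhds)] at hscore
  exact LocalAsymptotics.tendsto_nat_mul_integral_rootIncrement_sub_sq hpb hpa
    (hDD.tendsto_sqrt_smul_rootDensity_sub hD hp hs ha hb hk)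
    ((eventually_memLp_inner_score hD hp hs hb).mono fun n hn => hn k) hscore

include hsb

lemma isLindebergArray_rootIncrement :
    IsLindebergArray (fun n => densityLaw μ (p (b n)))
      (fun n => rootIncrement (p (b n)) (p (a n))) (quadForm (fisherInfo μ p score θ) k) :=
  (hDD.isLindebergArray_score hD hp hs hb hpb hsb k).of_sub
    (fun n => measurable_rootIncrement (hpb n).measurable (hpa n).measurable)
    (.of_forall fun n => memLp_rootIncrement (hpb n) (hpa n))
    (hDD.tendsto_nat_mul_integral_rootIncrement_sub_sq hD hp hs ha hb hpa hpb hk)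

end IsDDQM

end LocalParameters

end LocalAsymptotics

open LocalAsymptotics

theorem mainTheorem3 {𝒳 : Type*} [MeasurableSpace 𝒳] {d : ℕ} (μ : Measure 𝒳)
    (Θ : Set (EuclideanSpace ℝ (Fin d))) (hΘ : IsOpen Θ)
    (p : EuclideanSpace ℝ (Fin d) → 𝒳 → ℝ) (hp : LocalAsymptotics.IsDensityFamily μ Θ p)
    (score : EuclideanSpace ℝ (Fin d) → 𝒳 → EuclideanSpace ℝ (Fin d))
    (hscore_meas : ∀ θ' ∈ Θ, Measurable (score θ'))
    (θ : EuclideanSpace ℝ (Fin d)) (hθ : θ ∈ Θ)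
    (hscore : ∀ᶠ θ' in 𝓝 θ, LocalAsymptotics.HasDQMScore μ p (score θ') θ')
    (hDDQM : LocalAsymptotics.IsDDQM μ p score θ)
    (h h' : ℕ → EuclideanSpace ℝ (Fin d)) (k : EuclideanSpace ℝ (Fin d))
    (hhΘ : ∀ n, θ + h n ∈ Θ) (hh'Θ : ∀ n, θ + h' n ∈ Θ)
    (hh : Tendsto h atTop (𝓝 0)) (hh' : Tendsto h' atTop (𝓝 0))
    (hk : Tendsto (fun n : ℕ => √(n : ℝ) • (h n - h' n)) atTop (𝓝 k))
    {Ω : ℕ → Type*} [∀ n, MeasurableSpace (Ω n)] (P : ∀ n, Measure (Ω n))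
    [∀ n, IsProbabilityMeasure (P n)]
    (X : ∀ n, Fin n → Ω n → 𝒳)
    (hX_indep : ∀ n, iIndepFun (X n) (P n))
    (hX_law : ∀ n i, HasLaw (X n i) (LocalAsymptotics.law μ p (θ + h' n)) (P n)) :
    Tendsto (fun n => P n {ω | ∀ i, 0 < p (θ + h n) (X n i ω) ∧ 0 < p (θ + h' n) (X n i ω)})
        atTop (𝓝 1) ∧
    LocalAsymptotics.IsLittleOInProb P (fun n ω =>
      LocalAsymptotics.logLik p (fun i => X n i ω) (θ + h n)
        - LocalAsymptotics.logLik p (fun i => X n i ω) (θ + h' n)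
        - ((1 / √(n : ℝ))
              * inner ℝ k (LocalAsymptotics.sampleScore score (fun i => X n i ω) (θ + h' n))
            - (1 / 2) * LocalAsymptotics.quadForm (LocalAsymptotics.fisherInfo μ p score θ) k)) ∧
    TendstoInDistribution
      (fun n ω => LocalAsymptotics.logLik p (fun i => X n i ω) (θ + h n)
        - LocalAsymptotics.logLik p (fun i => X n i ω) (θ + h' n))
      atTop id P
      (gaussianReal (-(1 / 2) * LocalAsymptotics.quadForm (LocalAsymptotics.fisherInfo μ p score θ) k)
        (LocalAsymptotics.quadForm (LocalAsymptotics.fisherInfo μ p score θ) k).toNNReal) := by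
  have htendsto {u : ℕ → EuclideanSpace ℝ (Fin d)} (hu : Tendsto u atTop (𝓝 0)) :
      Tendsto (fun n => θ + u n) atTop (𝓝 θ) := by
    simpa using hu.const_add θ
  have hΘ_near := hΘ.eventually_mem hθ
  have hdens := hΘ_near.mono fun _ => hp.isDensity
  have hmeas := hΘ_near.mono hscore_meas
  have ha := htendsto hh
  have hb := htendsto hh'
  have h₁ (n : ℕ) := hp.isDensity (hhΘ n)
  have h₀ (n : ℕ) := hp.isDensity (hh'Θ n)
  have hs (n : ℕ) := hscore_meas _ (hh'Θ n)
  simp only [← add_sub_add_left_eq_sub (h _) (h' _) θ] at hk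
  have hv := hDDQM.isLindebergArray_score hscore hdens hmeas hb h₀ hs k
  have hw := hDDQM.isLindebergArray_rootIncrement hscore hdens hmeas ha hb h₁ h₀ hs hk
  have hw₁ := hDDQM.tendsto_nat_mul_integral_rootIncrement hscore hdens hmeas ha hb h₁ h₀ hk
  have hwv := hDDQM.tendsto_nat_mul_integral_rootIncrement_sub_sq hscore hdens hmeas ha hb h₁ h₀ hk
  have hv₀ := eventually_integral_inner_score_eq_zero hscore hdens hmeas hb k
  refine ⟨tendsto_measure_forall_pos h₀ hw hX_law, ?_,
    tendstoInDistribution_sum_log_sub h₀ (fun n => (h₁ n).measurable) hw hw₁ hX_indep hX_law⟩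
  simpa only [logLik, sampleScore, inner_sum, Finset.mul_sum] using
    isLittleOInProb_sum_log_sub h₀ hv
      (hv₀.mono fun n hn => by rw [integral_const_mul, hn, mul_zero]) hw hw₁ hwv hX_indep hX_law
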